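/- All rings are commutative with unity; a local ring is a ring with a unique maximal ideal, not necessarily Noetherian. An ideal $I$ of a ring $R$ is \emph{stable} if it is projective as a module over its endomorphism ring $\operatorname{End}_R(I)$; $R$ is \emph{stable} if each nonzero ideal of $R$ is stable, and a domain is \emph{finitely stable} if each nonzero finitely generated ideal is stable. A domain $R$ is \emph{Archimedean} if $\bigcap_{n\ge 0} r^nR=(0)$ for each nonunit $r\in R$; it satisfies \emph{accp} if it satisfies the ascending chain condition on principal ideals. A valuation (or Pr\"ufer) domain is \emph{strongly discrete} if no nonzero prime ideal is idempotent. An extension $R\subseteq D$ of domains is \emph{quadratic} if $xy\in xR+yR+R$ for all $x,y\in D$. $R'$ denotes the integral closure of a domain $R$ in its field of fractions. Let $(V_1,Q_1)$ and $(V_2,Q_2)$ be two valuation domains with no inclusion relation among them, with principal maximal ideals, with the same field of fractions $L$, containing a field $k$, and such that $V_i=k+Q_i$ for $i=1,2$. Let $D=V_1\cap V_2$, $N_i=Q_i\cap D$ for $i=1,2$, $M=N_1\cap N_2$, and $R=k+M$. \textbf{A.} The following hold. \begin{enumerate} \item $N_1$ and $N_2$ are the only maximal ideals of $D$, $N_1\neq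 N_2$, and $N_1,N_2$ are principal. We have $D_{N_i}=V_i$ for $i=1,2$, $D$ is Pr\"ufer, $\operatorname{Frac}D=L$, and $D=k+N_i$ for $i=1,2$. \item If $N_1=xD$, then $D=R+xR$; $D$ is a $2$-generated $R$-module, $M$ is a principal ideal of $D$ and a $2$-generated ideal of $R$, $D$ is a quadratic extension of $R$, $\operatorname{Frac}R=L$, and $D=R'=(M:M)$, where $(M:M)=\{t\in L : tM\subseteq M\}$. \item $R$ is a local domain with maximal ideal $M$. \item $R$ is finitely stable and its maximal ideal $M$ is stable. \item $R$ is stable if and only if $D$ is stable, if and only if $D$ is strongly discrete. \item $R$ is Archimedean if and only if one of $V_1,V_2$ is one-dimensional; and if $V_i$ is one-dimensional, it is a DVR. \item $\dim R>1$ if and only if $\dim V_i>1$ for some $i\in\{1,2\}$. \end{enumerate} \textbf{B.} Assume in addition that $V_1,V_2$ are strongly discrete, $\dim V_1=1$ and $\dim V_2=n$, where $2\le n\le\infty$. Then $R$ is an $n$-dimensional Archimedean stable local domain, $R$ satisfies accp, $R'$ is not Archimedean, and the pair $(R,D)$ (where $D=R'$) does not satisfy going-down. \textbf{C.} For every field $k$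 and every $2\le n\le\infty$ there exist a field $L\supseteq k$ and valuation domains $V_1,V_2$ of $L$ that satisfy all the hypotheses of B. Moreover, for every field $k$ and every $1\le n\le\infty$ there is an $n$-dimensional Archimedean stable local domain $R$ with accp that contains $k$ and whose residue field is $k$ (via the canonical map), such that, if $n\ge2$, $R'$ is not Archimedean and the pair $(R,R')$ does not satisfy going-down. -/

import Mathlib

universe u v

/-- An ideal is stable if it is projective as a module over its endomorphism ring. -/
def IsStableIdeal {R : Type u} [CommRing R] (I : Ideal R) : Prop :=
  Module.Projective (Module.End R I) I

/-- A ring is stable if each nonzero ideal is stable. -/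
def IsStableRing (R : Type u) [CommRing R] : Prop :=
  ∀ I : Ideal R, I ≠ ⊥ → IsStableIdeal I

/-- A domain is finitely stable if each nonzero finitely generated ideal is stable. -/
def IsFinitelyStableDomain (R : Type u) [CommRing R] : Prop :=
  ∀ I : Ideal R, I.FG → I ≠ ⊥ → IsStableIdeal I

/-- A domain is Archimedean if `⋂ₙ rⁿR = 0` for each nonunit `r`. -/
def IsArchimedeanDomain (R : Type u) [CommRing R] : Prop :=
  ∀ r : R, ¬ IsUnit r → (⨅ n : ℕ, Ideal.span {r ^ n}) = (⊥ : Ideal R)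

/-- The ascending chain condition on principal ideals. -/
def SatisfiesACCP (R : Type u) [CommRing R] : Prop :=
  ∀ f : ℕ →o Ideal R, (∀ n, (f n).IsPrincipal) → ∃ n, ∀ m, n ≤ m → f n = f m

/-- No nonzero prime ideal is idempotent. For valuation (or Prüfer) domains this is
strong discreteness. -/
def IsStronglyDiscrete (R : Type u) [CommRing R] : Prop :=
  ∀ P : Ideal R, P.IsPrime → P ≠ ⊥ → P * P ≠ P

/-- A domain is Prüfer if each nonzero finitely generated ideal is invertible. -/
def IsPruferDomain (R : Type u) [CommRing R] [IsDomain R] : Prop :=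
  ∀ I : Ideal R, I.FG → I ≠ ⊥ →
    IsUnit (I : FractionalIdeal (nonZeroDivisors R) (FractionRing R))

/-- `D` is a quadratic extension of `R`: `x y ∈ xR + yR + R` for all `x, y ∈ D`. -/
def IsQuadraticExtension (R : Type u) (D : Type v) [CommRing R] [CommRing D] [Algebra R D] :
    Prop :=
  ∀ x y : D, ∃ a b c : R, x * y = a • x + b • y + algebraMap R D c

/-- Two valuation domains of a field `L`, with no inclusion relation among them, with principal
maximal ideals `Q₁`, `Q₂`, both containing the field `k`, and such that `Vᵢ = k + Qᵢ`. -/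
structure ValuationPair (k : Type u) (L : Type v) [Field k] [Field L] [Algebra k L] where
  V₁ : ValuationSubring L
  V₂ : ValuationSubring L
  not_le₁₂ : ¬ V₁ ≤ V₂
  not_le₂₁ : ¬ V₂ ≤ V₁
  principal₁ : (IsLocalRing.maximalIdeal V₁).IsPrincipal
  principal₂ : (IsLocalRing.maximalIdeal V₂).IsPrincipal
  mem₁ : ∀ c : k, algebraMap k L c ∈ V₁
  mem₂ : ∀ c : k, algebraMap k L c ∈ V₂
  decomp₁ : ∀ x : V₁, ∃ c : k, ∃ q ∈ IsLocalRing.maximalIdeal V₁,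
    (x : L) = algebraMap k L c + (q : L)
  decomp₂ : ∀ x : V₂, ∃ c : k, ∃ q ∈ IsLocalRing.maximalIdeal V₂,
    (x : L) = algebraMap k L c + (q : L)

namespace ValuationPair

variable {k : Type u} {L : Type v} [Field k] [Field L] [Algebra k L] (P : ValuationPair k L)

/-- `D = V₁ ∩ V₂`. -/
def D : Subalgebra k L where
  toSubsemiring := (P.V₁.toSubring ⊓ P.V₂.toSubring).toSubsemiring
  algebraMap_mem' c := ⟨P.mem₁ c, P.mem₂ c⟩

/-- The inclusion `D → V₁`. -/
def incl₁ : P.D →+* P.V₁ where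
  toFun x := ⟨x, x.2.1⟩
  map_one' := rfl
  map_mul' _ _ := rfl
  map_zero' := rfl
  map_add' _ _ := rfl

/-- The inclusion `D → V₂`. -/
def incl₂ : P.D →+* P.V₂ where
  toFun x := ⟨x, x.2.2⟩
  map_one' := rfl
  map_mul' _ _ := rfl
  map_zero' := rfl
  map_add' _ _ := rfl

/-- `N₁ = Q₁ ∩ D`. -/
def N₁ : Ideal P.D := (IsLocalRing.maximalIdeal P.V₁).comap P.incl₁

/-- `N₂ = Q₂ ∩ D`. -/
def N₂ : Ideal P.D := (IsLocalRing.maximalIdeal P.V₂).comap P.incl₂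

/-- `M = N₁ ∩ N₂`. -/
def M : Ideal P.D := P.N₁ ⊓ P.N₂

/-- `R = k + M`. -/
def R : Subalgebra k P.D where
  carrier := {x | ∃ c : k, ∃ m ∈ P.M, x = algebraMap k P.D c + m}
  algebraMap_mem' c := ⟨c, 0, P.M.zero_mem, by simp⟩
  add_mem' := by
    rintro _ _ ⟨c, m, hm, rfl⟩ ⟨d, l, hl, rfl⟩
    exact ⟨c + d, m + l, P.M.add_mem hm hl, by rw [map_add]; ring⟩
  mul_mem' := by
    rintro _ _ ⟨c, m, hm, rfl⟩ ⟨d, l, hl, rfl⟩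
    refine ⟨c * d, algebraMap k P.D c * l + (algebraMap k P.D d + l) * m,
      P.M.add_mem (P.M.mul_mem_left _ hl) (P.M.mul_mem_left _ hm), ?_⟩
    rw [map_mul]; ring

/-- `M`, which is contained in `R`, as an ideal of `R`. -/
def MR : Ideal P.R := P.M.comap (algebraMap P.R P.D)

end ValuationPair

/-!
The proof rests on comparing the two valuations `v₁`, `v₂` of `L`.

**The ring `D`.** For `a, b ∈ L` one of `a`, `b`, `a + b` has, for both valuations at once, the
larger of the values of `a` and `b` (`ValuationSubring.exists_common_bound`). Hence `D` is Bézout,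
every element of `L` is a fraction whose denominator is a unit wherever possible
(`ValuationPair.exists_common_denominator`), and the localizations of `D` at `N₁`, `N₂` are `V₁`,
`V₂`. An element of `D` outside `R` has two distinct residues, so `D` is spanned
by it and `1` over `R`.

**Stability.** If `w ∈ I` and `I² = wI`, then evaluation at `w` identifies `End I` with `I`, so `I`
is stable (`isStableIdeal_of_mul_eq`). For a `k`-subspace `S` of `L` that is closed under
multiplication by `M`, let `w ∈ S` satisfy `(Vᵢ S)² ⊆ w Vᵢ S` for `i = 1, 2`. With `E` the ring of
multipliers of `V₁ S` and `V₂ S`, the space `w⁻¹ S` satisfies `M E ⊆ w⁻¹ S ⊆ E`, and `E / M E`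
embeds in `k × k`; so `w⁻¹ S` is `k + M E` or `E`, and is closed under multiplication in either case
(`ValuationPair.exists_mul_eq_of_isReduction`). Such a `w` exists for finitely generated ideals of
`R` and `D`, and for all nonzero ideals if `V₁` and `V₂` are strongly discrete: an ideal `J` of a
strongly discrete valuation ring is invertible over the localization at the prime
`{z | z J ≠ J}` (`exists_mul_dvd_of_isStronglyDiscrete`). Conversely a dual basis shows that an
idempotent proper nonzero ideal is not stable (`IsStableIdeal.mul_self_ne_of_map_eq`); applied to an
ideal `p` of `D`, or to the ideal `m p` of `R` where `m` generates `M`, it shows that `D` is strongly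
discrete if `D` or `R` is stable.

**Dimension, the Archimedean property, going-down.** As `R ⊆ D` is integral, `R` and `D` have the
dimension `max (dim V₁) (dim V₂)`. The inclusions of `R` in `V₁` and `V₂` are local, so `R` inherits
the Archimedean property and the chain condition from a discrete valuation ring `Vᵢ`. In `D`, a
generator of `N₂` is a unit of `V₁`, and so its powers have a nonzero common multiple as soon as
`dim V₂ ≠ 1`. If `dim V₁ = 1 < dim V₂`, no nonzero prime of `D` lies strictly below `N₁`, although
`N₁` lies over the maximal ideal of `R` and `dim R > 1`; hence going-down fails.

**Examples.** Let `L = k(xᵢ : i ∈ ι)` with `ι = Fin n` or `ι = ℕ`. Sending `xᵢ` to the monomial with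
exponent `eᵢ` embeds `L` in the Hahn series with exponents in the colexicographically ordered group
`ℤ^(ι)`, and sending the `xᵢ` to algebraically independent power series
(`PowerSeries.exists_algebraicIndependent`) embeds it in `k((t))`. Both pulled back valuations have
residue field `k`. The primes of the first valuation ring correspond, in reverse order, to the elements
of `ι` with a largest one, for the zero ideal, added
(`ValuationSubring.ringKrullDim_of_eq_colexBasis`); the second valuation ring is
discrete of rank one. In dimension one, `k[[t]]` is an example.
-/

universe w

/-! ### Stable ideals of domains -/

/-- If `w ∈ I` and `I² = wI`, then evaluation at `w` is an isomorphism `End I ≃ I`, so that `I` is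
free of rank one over `End I`. -/
theorem isStableIdeal_of_mul_eq {R : Type u} [CommRing R] [IsDomain R] (I : Ideal R) (w : R)
    (hw : w ∈ I) (hw0 : w ≠ 0) (h : ∀ b ∈ I, ∀ c ∈ I, ∃ d ∈ I, b * c = w * d) :
    IsStableIdeal I := by
  -- endomorphisms of `I` are multiplications by elements of the field of fractions
  have key : ∀ (f : Module.End R I) (u v : I), (u : R) * (f v : R) = v * f u := by
    intro f u v
    have h1 : f ((u : R) • v) = f ((v : R) • u) := by
      congr 1
      ext
      simp [mul_comm]
    rw [map_smul, map_smul] at h1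
    simpa using congrArg Subtype.val h1
  let e : Module.End R I →ₗ[Module.End R I] I :=
    { toFun := fun f => f ⟨w, hw⟩
      map_add' := fun f g => rfl
      map_smul' := fun f g => rfl }
  have hinj : Function.Injective e := by
    intro f g hfg
    ext u
    have h1 := key f ⟨w, hw⟩ u
    have h2 := key g ⟨w, hw⟩ u
    have h3 : f ⟨w, hw⟩ = g ⟨w, hw⟩ := hfg
    rw [h3, ← h2] at h1
    exact mul_left_cancel₀ hw0 h1
  have hsurj : Function.Surjective e := by
    intro b
    choose d hd using fun c : I => h b b.2 c c.2
    -- the endomorphism that sends `c` to `b c / w`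
    refine ⟨{ toFun := fun c => ⟨d c, (hd c).1⟩, map_add' := ?_, map_smul' := ?_ }, ?_⟩
    · intro c c'
      ext
      apply mul_left_cancel₀ hw0
      have h1 := (hd c).2
      have h2 := (hd c').2
      have h3 := (hd (c + c')).2
      push_cast at h3 ⊢
      linear_combination h1 + h2 - h3
    · intro r c
      ext
      apply mul_left_cancel₀ hw0
      have h1 := (hd c).2
      have h3 := (hd (r • c)).2
      simp only [SetLike.val_smul, smul_eq_mul, RingHom.id_apply] at h3 ⊢
      linear_combination r * h1 - h3
    · ext
      apply mul_left_cancel₀ hw0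
      change w * d ⟨w, hw⟩ = _
      rw [← (hd ⟨w, hw⟩).2, mul_comm]
  exact Module.Projective.of_equiv' (LinearEquiv.ofBijective e ⟨hinj, hsurj⟩)

/-- A dual basis of a stable ideal `I`, cleared of denominators: with `E = End I`, the elements
`c x / z²` of the field of fractions map `I` to `E`, and `∑ (c x / z²) x = 1`. -/
theorem IsStableIdeal.exists_dual {R : Type u} [CommRing R] [IsDomain R] {I : Ideal R}
    (hI : IsStableIdeal I) {z : R} (hz : z ∈ I) :
    ∃ (s : Finset R) (c : R → R), (∀ x ∈ s, x ∈ I) ∧ (∀ x ∈ s, c x ∈ I) ∧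
      (∑ x ∈ s, c x * x = z ^ 2) ∧
      ∀ x ∈ s, ∀ u ∈ I, ∀ w ∈ I, ∃ v ∈ I, c x * u * w = z ^ 2 * v := by
  classical
  have key : ∀ (f : Module.End R I) (u v : I), (u : R) * (f v : R) = v * f u := by
    intro f u v
    have h1 : f ((u : R) • v) = f ((v : R) • u) := by
      congr 1
      ext
      simp [mul_comm]
    rw [map_smul, map_smul] at h1
    simpa using congrArg Subtype.val h1
  -- a section of the canonical surjection from the free `End I`-module on the set `I`
  obtain ⟨σ, hσ⟩ := hI.out
  -- the section is linear over the scalars `R`, which act through `End R I`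
  have hlin : ∀ (r : R) (u : I), σ (r • u) = (algebraMap R (Module.End R I) r) • σ u := by
    intro r u
    rw [← map_smul]
    rfl
  let zI : I := ⟨z, hz⟩
  let c : R → R := fun x => if h : x ∈ I then (σ zI ⟨x, h⟩ zI : I) else 0
  have hc : ∀ x : I, c x = (σ zI x zI : I) := fun x => by simp [c]
  have hcomm : ∀ (u x w : I), z * (σ u x w : R) = u * (σ zI x w : I) := by
    intro u x w
    have h1 : (z : R) • u = (u : R) • zI := by
      ext
      simp [zI, mul_comm]
    have h2 := congrArg (fun t => (((t x) w : I) : R)) (congrArg σ h1)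
    simpa [hlin] using h2
  refine ⟨(σ zI).support.image Subtype.val, c, ?_, ?_, ?_, ?_⟩
  · intro x hx
    obtain ⟨y, -, rfl⟩ := Finset.mem_image.1 hx
    exact y.2
  · intro x hx
    obtain ⟨y, -, rfl⟩ := Finset.mem_image.1 hx
    rw [hc]
    exact Subtype.coe_prop _
  · rw [Finset.sum_image (fun _ _ _ _ h => Subtype.ext h)]
    have h1 := hσ zI
    rw [Finsupp.linearCombination_apply, Finsupp.sum] at h1
    have h2 := congrArg (fun t : I => (t : R)) h1
    simp only [AddSubmonoidClass.coe_finsetSum, Module.End.smul_def, id] at h2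
    calc ∑ x ∈ (σ zI).support, c x * x = ∑ x ∈ (σ zI).support, z * (σ zI x x : I) := by
          refine Finset.sum_congr rfl fun x _ => ?_
          rw [hc, mul_comm, key (σ zI x) x zI]
      _ = z ^ 2 := by rw [← Finset.mul_sum, h2, sq]
  · intro x hx u hu w hw
    obtain ⟨y, -, rfl⟩ := Finset.mem_image.1 hx
    refine ⟨(σ ⟨u, hu⟩ y ⟨w, hw⟩ : I), Subtype.coe_prop _, ?_⟩
    rw [hc]
    have h1 := hcomm ⟨u, hu⟩ y ⟨w, hw⟩
    have h2 := key (σ zI y) ⟨w, hw⟩ zI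
    simp only [zI] at h1 h2 ⊢
    linear_combination u * h2 - z * h1

/-- A stable ideal whose image in an overring `D` is `m P` forces the proper nonzero ideal `P` of
`D` to be non-idempotent. In a dual basis, `x ∈ m P = m P²` makes `c x · x` an element of `z² P`; the
sum `z²` of these elements would then be in `z² P`. -/
theorem IsStableIdeal.mul_self_ne_of_map_eq {R : Type u} {D : Type v} [CommRing R] [IsDomain R]
    [CommRing D] [IsDomain D] (φ : R →+* D) {I : Ideal R} (hI : IsStableIdeal I) {P : Ideal D}
    {m : D} (hm : m ≠ 0) (hIP : ∀ r ∈ I, ∃ p ∈ P, φ r = m * p)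
    (hPI : ∀ p ∈ P, ∃ r ∈ I, φ r = m * p) (h0 : P ≠ ⊥) (h1 : P ≠ ⊤) : P * P ≠ P := by
  intro h
  obtain ⟨q, hq, hq0⟩ := Submodule.exists_mem_ne_zero_of_ne_bot h0
  obtain ⟨z, hz, hzq⟩ := hPI q hq
  have hz0 : φ z ≠ 0 := hzq ▸ mul_ne_zero hm hq0
  obtain ⟨s, c, hs, -, hsum, hv⟩ := hI.exists_dual hz
  have h2 : ∀ x ∈ s, φ (c x * x) ∈ Ideal.span {φ z ^ 2} * P := by
    intro x hx
    obtain ⟨p, hp, hxp⟩ := hIP x (hs x hx)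
    rw [map_mul, hxp]
    rw [← h] at hp
    refine Submodule.mul_induction_on hp ?_ ?_
    · intro u hu w hw
      obtain ⟨u', hu', eu⟩ := hPI u hu
      obtain ⟨w', hw', ew⟩ := hPI w hw
      obtain ⟨v, hvI, e⟩ := hv x hx u' hu' w' hw'
      obtain ⟨p', hp', ev⟩ := hIP v hvI
      have e' := congrArg φ e
      simp only [map_mul, map_pow, eu, ew, ev] at e'
      have : φ (c x) * (m * (u * w)) = φ z ^ 2 * p' :=
        mul_left_cancel₀ hm (by linear_combination e')
      rw [this]
      exact Ideal.mul_mem_mul (Ideal.mem_span_singleton_self _) hp'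
    · intro a b ha hb
      rw [mul_add, mul_add]
      exact Ideal.add_mem _ ha hb
  have h3 := Ideal.sum_mem _ h2
  rw [← map_sum, hsum, map_pow, Ideal.mem_span_singleton_mul] at h3
  obtain ⟨y, hy, e⟩ := h3
  have : y = 1 := mul_left_cancel₀ (pow_ne_zero 2 hz0) (by rw [e, mul_one])
  exact h1 ((Ideal.eq_top_iff_one P).2 (this ▸ hy))

theorem IsStableIdeal.mul_self_ne {R : Type u} [CommRing R] [IsDomain R] {I : Ideal R}
    (hI : IsStableIdeal I) (h0 : I ≠ ⊥) (h1 : I ≠ ⊤) : I * I ≠ I :=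
  hI.mul_self_ne_of_map_eq (RingHom.id R) one_ne_zero (fun r hr => ⟨r, hr, by simp⟩)
    (fun p hp => ⟨p, hp, by simp⟩) h0 h1

theorem IsStableRing.isStronglyDiscrete {R : Type u} [CommRing R] [IsDomain R]
    (h : IsStableRing R) : IsStronglyDiscrete R :=
  fun P hP h0 => (h P h0).mul_self_ne h0 hP.ne_top

theorem IsStableRing.of_isPrincipalIdealRing (R : Type u) [CommRing R] [IsDomain R]
    [IsPrincipalIdealRing R] : IsStableRing R := by
  intro I hI
  obtain ⟨w, rfl⟩ := IsPrincipalIdealRing.principal I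
  refine isStableIdeal_of_mul_eq _ w (Ideal.mem_span_singleton_self w) ?_ ?_
  · rintro rfl
    simp at hI
  · intro b hb c hc
    obtain ⟨r, rfl⟩ := Ideal.mem_span_singleton.1 hb
    exact ⟨r * c, Ideal.mul_mem_left _ _ hc, by ring⟩

/-- Over a strongly discrete valuation ring each nonzero ideal `J` contains some `a` with
`J² = a J`. With `P` the prime of all `z` such that `z J ≠ J`, the ideal `J` is a module over the
localization at `P`, and `a` generates it over this localization. -/
theorem exists_mul_dvd_of_isStronglyDiscrete {V : Type u} [CommRing V] [IsDomain V]
    [ValuationRing V] (hV : IsStronglyDiscrete V) (J : Ideal V) (hJ : J ≠ ⊥) :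
    ∃ a ∈ J, ∀ b ∈ J, ∀ c ∈ J, ∃ d ∈ J, b * c = a * d := by
  -- the prime ideal of all elements `z` with `z J ≠ J`
  let A : Set V := {z | ∃ b ∈ J, ∀ d ∈ J, b ≠ z * d}
  have hcompl : ∀ {z}, z ∉ A → ∀ b ∈ J, ∃ d ∈ J, b = z * d := by
    intro z hz b hb
    by_contra hcon
    push Not at hcon
    exact hz ⟨b, hb, hcon⟩
  have hmul : ∀ {z : V} (r : V), z ∈ A → r * z ∈ A := by
    rintro z r ⟨b, hb, h⟩
    refine ⟨b, hb, fun d hd e => h (r * d) (J.mul_mem_left _ hd) ?_⟩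
    rw [e]; ring
  obtain ⟨j, hj, hj0⟩ := Submodule.exists_mem_ne_zero_of_ne_bot hJ
  have h0 : (0 : V) ∈ A := ⟨j, hj, fun d _ => by simpa using hj0⟩
  let P : Ideal V :=
    { carrier := A
      zero_mem' := h0
      smul_mem' := fun r z hz => hmul r hz
      add_mem' := by
        intro z w hz hw
        rcases ValuationRing.dvd_total z w with ⟨r, rfl⟩ | ⟨r, rfl⟩
        · rw [show z + z * r = (1 + r) * z by ring]; exact hmul _ hz
        · rw [show w * r + w = (r + 1) * w by ring]; exact hmul _ hw }
  have hmem : ∀ z, z ∈ P ↔ z ∈ A := fun z => Iff.rfl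
  have hP : P.IsPrime := by
    refine ⟨?_, ?_⟩
    · rw [Ideal.ne_top_iff_one, hmem]
      rintro ⟨b, hb, h⟩
      exact h b hb (one_mul b).symm
    · intro x y hxy
      by_contra! hcon
      obtain ⟨b, hb, h⟩ := hxy
      obtain ⟨d, hd, e⟩ := hcompl hcon.1 b hb
      obtain ⟨d', hd', e'⟩ := hcompl hcon.2 d hd
      exact h d' hd' (by rw [e, e', mul_assoc])
  by_cases hP0 : P = ⊥
  · -- then `j J = J`, so that `1 ∈ J`
    have hj' : j ∉ A := fun h => hj0 (by simpa [hP0] using (hmem j).2 h)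
    obtain ⟨d, hd, e⟩ := hcompl hj' j hj
    have hd1 : d = 1 := mul_left_cancel₀ hj0 (by rw [← e, mul_one])
    subst hd1
    exact ⟨1, hd, fun b _ c hc => ⟨b * c, J.mul_mem_left _ hc, (one_mul _).symm⟩⟩
  · -- for `p ∈ P` outside `P²`, any `a ∈ J` outside `p J` will do
    obtain ⟨p, hp, hpp⟩ := SetLike.exists_of_lt
      (lt_of_le_of_ne Ideal.mul_le_left (hV P hP hP0))
    obtain ⟨a, ha, hpa⟩ := (hmem p).1 hp
    refine ⟨a, ha, fun b hb c hc => ?_⟩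
    rcases ValuationRing.dvd_total a b with ⟨r, rfl⟩ | ⟨r, rfl⟩
    · exact ⟨r * c, J.mul_mem_left _ hc, by ring⟩
    · by_cases hr : r ∈ A
      · exfalso
        rcases ValuationRing.dvd_total p r with ⟨q, rfl⟩ | ⟨q, rfl⟩
        · exact hpa (q * b) (J.mul_mem_left _ hb) (by ring)
        · have hq : q ∉ A := fun hq => hpp (Ideal.mul_mem_mul hr hq)
          obtain ⟨d, hd, e⟩ := hcompl hq b hb
          exact hpa d hd (by rw [e]; ring)
      · obtain ⟨d, hd, e⟩ := hcompl hr c hc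
        exact ⟨d, hd, by rw [e]; ring⟩

/-! ### Approximation for two valuation rings of a field -/

section TwoValuations

variable {L : Type v} [Field L] (V W : ValuationSubring L)

/-- One of `a`, `b`, `a + b` has, for both valuations, the larger of the values of `a` and `b`. -/
theorem ValuationSubring.exists_common_bound (a b : L) :
    ∃ g : L, (g = a ∨ g = b ∨ g = a + b) ∧
      (V.valuation a ≤ V.valuation g ∧ V.valuation b ≤ V.valuation g) ∧
      (W.valuation a ≤ W.valuation g ∧ W.valuation b ≤ W.valuation g) := by
  rcases lt_trichotomy (V.valuation a) (V.valuation b) with h | h | h <;>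
  rcases lt_trichotomy (W.valuation a) (W.valuation b) with h' | h' | h'
  · exact ⟨b, by simp, ⟨h.le, le_rfl⟩, h'.le, le_rfl⟩
  · exact ⟨b, by simp, ⟨h.le, le_rfl⟩, h'.le, le_rfl⟩
  · refine ⟨a + b, by simp, ?_⟩
    rw [Valuation.map_add_eq_of_lt_right _ h, Valuation.map_add_eq_of_lt_left _ h']
    exact ⟨⟨h.le, le_rfl⟩, le_rfl, h'.le⟩
  · exact ⟨b, by simp, ⟨h.le, le_rfl⟩, h'.le, le_rfl⟩
  · exact ⟨b, by simp, ⟨h.le, le_rfl⟩, h'.le, le_rfl⟩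
  · exact ⟨a, by simp, ⟨le_rfl, h.ge⟩, le_rfl, h'.le⟩
  · refine ⟨a + b, by simp, ?_⟩
    rw [Valuation.map_add_eq_of_lt_left _ h, Valuation.map_add_eq_of_lt_right _ h']
    exact ⟨⟨le_rfl, h.le⟩, h'.le, le_rfl⟩
  · exact ⟨a, by simp, ⟨le_rfl, h.le⟩, le_rfl, h'.ge⟩
  · exact ⟨a, by simp, ⟨le_rfl, h.le⟩, le_rfl, h'.le⟩

variable {V W}

/-- An element of `a V ∩ b W` is in the module generated by `a` and `b` over `V ∩ W`. -/
theorem ValuationSubring.exists_eq_mul_add_mul {z a b : L} (h₁ : V.valuation z ≤ V.valuation a)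
    (h₂ : W.valuation z ≤ W.valuation b) :
    ∃ α β : L, (α ∈ V ∧ α ∈ W) ∧ (β ∈ V ∧ β ∈ W) ∧ z = α * a + β * b := by
  obtain ⟨g, hg, ⟨hVa, hVb⟩, hWa, hWb⟩ := exists_common_bound V W a b
  have hzero : (0 : L) ∈ V ∧ (0 : L) ∈ W := ⟨zero_mem _, zero_mem _⟩
  by_cases hg0 : g = 0
  · have hz : z = 0 := by
      have := h₁.trans hVa
      simpa [hg0] using this
    exact ⟨0, 0, hzero, hzero, by simp [hz]⟩
  · have hzg : z / g ∈ V ∧ z / g ∈ W := by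
      rw [← V.valuation_le_one_iff, ← W.valuation_le_one_iff, map_div₀, map_div₀]
      exact ⟨div_le_one_of_le₀ (h₁.trans hVa) zero_le,
        div_le_one_of_le₀ (h₂.trans hWb) zero_le⟩
    have hz : z = z / g * g := (div_mul_cancel₀ z hg0).symm
    rcases hg with hg | hg | hg
    · exact ⟨z / g, 0, hzg, hzero, by rw [← hg, zero_mul, add_zero, ← hz]⟩
    · exact ⟨0, z / g, hzero, hzg, by rw [← hg, zero_mul, zero_add, ← hz]⟩
    · exact ⟨z / g, z / g, hzg, hzg, by rw [← mul_add, ← hg, ← hz]⟩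

theorem ValuationSubring.exists_lt_one_and_one_lt (h₁ : ¬ V ≤ W) (h₂ : ¬ W ≤ V) :
    ∃ c : L, V.valuation c < 1 ∧ 1 < W.valuation c := by
  obtain ⟨a, ha, ha'⟩ := SetLike.not_le_iff_exists.1 h₁
  obtain ⟨b, hb, hb'⟩ := SetLike.not_le_iff_exists.1 h₂
  rw [← valuation_le_one_iff] at ha hb
  rw [← valuation_le_one_iff, not_le] at ha' hb'
  refine ⟨a / b, ?_, ?_⟩
  · rw [map_div₀]
    exact (div_lt_one₀ (zero_lt_one.trans hb')).2 (ha.trans_lt hb')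
  · have hb0 : b ≠ 0 := by
      rintro rfl
      simp at hb'
    rw [map_div₀]
    exact (one_lt_div₀ ((Valuation.pos_iff _).2 hb0)).2 (hb.trans_lt ha')

theorem Valuation.map_div_one_add_of_lt {Γ : Type*} [LinearOrderedCommGroupWithZero Γ]
    (w : Valuation L Γ) {c : L} (hc : w c < 1) : w (c / (1 + c)) = w c := by
  rw [map_div₀, Valuation.map_one_add_of_lt _ hc, div_one]

theorem Valuation.map_div_one_add_of_gt {Γ : Type*} [LinearOrderedCommGroupWithZero Γ]
    (w : Valuation L Γ) {c : L} (hc : 1 < w c) : w (c / (1 + c)) = 1 := by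
  have h : w (1 + c) = w c := Valuation.map_add_eq_of_lt_right _ (by simpa using hc)
  rw [map_div₀, h, div_self (zero_lt_one.trans hc).ne']

/-- The maximal ideal of `V`, if principal, has a generator that is a unit of `W`. -/
theorem ValuationSubring.exists_valuation_eq_and_eq_one (h₁ : ¬ V ≤ W) (h₂ : ¬ W ≤ V) {π : L}
    (hπ : V.valuation π < 1) (hmax : ∀ q, V.valuation q < 1 → V.valuation q ≤ V.valuation π) :
    ∃ x, V.valuation x = V.valuation π ∧ W.valuation x = 1 := by
  rcases lt_trichotomy (W.valuation π) 1 with h | h | h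
  · -- `c / (1 + c)` has the value of `c` in `V`, and is a unit of `W`; it is a generator or may be
    -- corrected by `π`
    obtain ⟨c, hcV, hcW⟩ := exists_lt_one_and_one_lt h₁ h₂
    have hV := Valuation.map_div_one_add_of_lt V.valuation hcV
    have hW := Valuation.map_div_one_add_of_gt W.valuation hcW
    rcases (hmax c hcV).lt_or_eq with hlt | heq
    · refine ⟨c / (1 + c) + π, ?_, ?_⟩
      · exact Valuation.map_add_eq_of_lt_right _ (hV ▸ hlt)
      · rw [Valuation.map_add_eq_of_lt_left _ (by rwa [hW]), hW]
    · exact ⟨_, hV.trans heq, hW⟩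
  · exact ⟨π, rfl, h⟩
  · exact ⟨_, Valuation.map_div_one_add_of_lt _ hπ, Valuation.map_div_one_add_of_gt _ h⟩

theorem ValuationSubring.exists_max_valuation_lt_one
    (hV : (IsLocalRing.maximalIdeal V).IsPrincipal) :
    ∃ π : L, V.valuation π < 1 ∧ ∀ q, V.valuation q < 1 → V.valuation q ≤ V.valuation π := by
  obtain ⟨π, hπ⟩ := hV
  refine ⟨π, ?_, ?_⟩
  · rw [← V.valuation_lt_one_iff, hπ]
    exact Ideal.mem_span_singleton_self π
  · intro q hq
    have hqV : q ∈ V := (V.valuation_le_one_iff q).1 hq.le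
    have h := (V.valuation_lt_one_iff ⟨q, hqV⟩).2 hq
    rw [hπ] at h
    obtain ⟨r, hr⟩ := Ideal.mem_span_singleton.1 h
    refine (V.valuation_le_iff _ _).2 ⟨r, ?_⟩
    have := congrArg Subtype.val hr
    simpa [mul_comm] using this.symm

end TwoValuations

/-! ### The intersection `D` of the two valuation rings -/

namespace ValuationPair

variable {k : Type u} {L : Type v} [Field k] [Field L] [Algebra k L] (P : ValuationPair k L)

theorem mem_D_iff {z : L} : z ∈ P.D ↔ P.V₁.valuation z ≤ 1 ∧ P.V₂.valuation z ≤ 1 := by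
  rw [P.V₁.valuation_le_one_iff, P.V₂.valuation_le_one_iff]
  exact Iff.rfl

theorem mem_N₁_iff (d : P.D) : d ∈ P.N₁ ↔ P.V₁.valuation d < 1 :=
  P.V₁.valuation_lt_one_iff (P.incl₁ d)

theorem mem_N₂_iff (d : P.D) : d ∈ P.N₂ ↔ P.V₂.valuation d < 1 :=
  P.V₂.valuation_lt_one_iff (P.incl₂ d)

instance isPrime_N₁ : P.N₁.IsPrime := by unfold N₁; infer_instance

instance isPrime_N₂ : P.N₂.IsPrime := by unfold N₂; infer_instance

theorem valuation₁_le (d : P.D) : P.V₁.valuation d ≤ 1 := (P.mem_D_iff.1 d.2).1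

theorem valuation₂_le (d : P.D) : P.V₂.valuation d ≤ 1 := (P.mem_D_iff.1 d.2).2

theorem valuation₁_algebraMap {c : k} (hc : c ≠ 0) : P.V₁.valuation (algebraMap k L c) = 1 := by
  refine le_antisymm ((P.V₁.valuation_le_one_iff _).2 (P.mem₁ c)) ?_
  have h := (P.V₁.valuation_le_one_iff _).2 (P.mem₁ c⁻¹)
  rw [map_inv₀, map_inv₀] at h
  exact (inv_le_one₀ ((Valuation.pos_iff _).2 (by simpa using hc))).1 h

theorem valuation₂_algebraMap {c : k} (hc : c ≠ 0) : P.V₂.valuation (algebraMap k L c) = 1 := by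
  refine le_antisymm ((P.V₂.valuation_le_one_iff _).2 (P.mem₂ c)) ?_
  have h := (P.V₂.valuation_le_one_iff _).2 (P.mem₂ c⁻¹)
  rw [map_inv₀, map_inv₀] at h
  exact (inv_le_one₀ ((Valuation.pos_iff _).2 (by simpa using hc))).1 h

theorem exists_residue₁ {z : L} (hz : P.V₁.valuation z ≤ 1) :
    ∃ c : k, P.V₁.valuation (z - algebraMap k L c) < 1 := by
  obtain ⟨c, q, hq, e⟩ := P.decomp₁ ⟨z, (P.V₁.valuation_le_one_iff z).1 hz⟩
  refine ⟨c, ?_⟩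
  change z = _ at e
  rw [e, add_sub_cancel_left]
  exact (P.V₁.valuation_lt_one_iff q).1 hq

theorem exists_residue₂ {z : L} (hz : P.V₂.valuation z ≤ 1) :
    ∃ c : k, P.V₂.valuation (z - algebraMap k L c) < 1 := by
  obtain ⟨c, q, hq, e⟩ := P.decomp₂ ⟨z, (P.V₂.valuation_le_one_iff z).1 hz⟩
  refine ⟨c, ?_⟩
  change z = _ at e
  rw [e, add_sub_cancel_left]
  exact (P.V₂.valuation_lt_one_iff q).1 hq

theorem exists_sub_mem_N₁ (d : P.D) : ∃ c : k, d - algebraMap k P.D c ∈ P.N₁ := by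
  obtain ⟨c, hc⟩ := P.exists_residue₁ (P.valuation₁_le d)
  exact ⟨c, (P.mem_N₁_iff _).2 hc⟩

theorem exists_sub_mem_N₂ (d : P.D) : ∃ c : k, d - algebraMap k P.D c ∈ P.N₂ := by
  obtain ⟨c, hc⟩ := P.exists_residue₂ (P.valuation₂_le d)
  exact ⟨c, (P.mem_N₂_iff _).2 hc⟩

/-- An element of `D` dividing, for both valuations, an element `z` of `D` divides `z` in `D`. -/
theorem dvd_of_valuation_le {a z : P.D} (h₁ : P.V₁.valuation z ≤ P.V₁.valuation a)
    (h₂ : P.V₂.valuation z ≤ P.V₂.valuation a) : a ∣ z := by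
  obtain ⟨α, β, hα, hβ, e⟩ := ValuationSubring.exists_eq_mul_add_mul h₁ h₂
  refine ⟨⟨α, hα⟩ + ⟨β, hβ⟩, Subtype.ext ?_⟩
  change (z : L) = a * (α + β)
  rw [e]; ring

theorem isUnit_iff (d : P.D) : IsUnit d ↔ d ∉ P.N₁ ∧ d ∉ P.N₂ := by
  constructor
  · intro h
    exact ⟨fun h' => P.isPrime_N₁.ne_top (Ideal.eq_top_of_isUnit_mem _ h' h),
      fun h' => P.isPrime_N₂.ne_top (Ideal.eq_top_of_isUnit_mem _ h' h)⟩
  · rintro ⟨h₁, h₂⟩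
    rw [mem_N₁_iff, not_lt] at h₁
    rw [mem_N₂_iff, not_lt] at h₂
    refine isUnit_of_dvd_one (P.dvd_of_valuation_le ?_ ?_)
    · simpa using h₁
    · simpa using h₂

/-- Besides being a generator of `N₁`, the element `x` is a unit of `V₂` and a generator of the
maximal ideal of `V₁`. -/
theorem exists_generator_N₁ : ∃ x : P.D, P.N₁ = Ideal.span {x} ∧ P.V₂.valuation x = 1 ∧
    P.V₁.valuation x ≠ 0 ∧ ∀ q, P.V₁.valuation q < 1 → P.V₁.valuation q ≤ P.V₁.valuation x := by
  obtain ⟨π, hπ, hmax⟩ := ValuationSubring.exists_max_valuation_lt_one P.principal₁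
  obtain ⟨x, hx₁, hx₂⟩ :=
    ValuationSubring.exists_valuation_eq_and_eq_one P.not_le₁₂ P.not_le₂₁ hπ hmax
  have hx : x ∈ P.D := P.mem_D_iff.2 ⟨hx₁.trans_le hπ.le, hx₂.le⟩
  refine ⟨⟨x, hx⟩, le_antisymm ?_ ?_, hx₂, ?_, fun q hq => (hmax q hq).trans_eq hx₁.symm⟩
  · intro d hd
    rw [Ideal.mem_span_singleton]
    refine P.dvd_of_valuation_le ?_ ?_
    · exact (hmax _ ((P.mem_N₁_iff d).1 hd)).trans_eq hx₁.symm
    · exact (P.valuation₂_le d).trans_eq hx₂.symm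
  · rw [Ideal.span_singleton_le_iff_mem, mem_N₁_iff]
    exact hx₁.trans_lt hπ
  · change P.V₁.valuation x ≠ 0
    rw [Valuation.ne_zero_iff]
    rintro rfl
    simp at hx₂

/-- Besides being a generator of `N₂`, the element `y` is a unit of `V₁` and a generator of the
maximal ideal of `V₂`. -/
theorem exists_generator_N₂ : ∃ y : P.D, P.N₂ = Ideal.span {y} ∧ P.V₁.valuation y = 1 ∧
    P.V₂.valuation y ≠ 0 ∧ ∀ q, P.V₂.valuation q < 1 → P.V₂.valuation q ≤ P.V₂.valuation y := by
  obtain ⟨π, hπ, hmax⟩ := ValuationSubring.exists_max_valuation_lt_one P.principal₂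
  obtain ⟨y, hy₂, hy₁⟩ :=
    ValuationSubring.exists_valuation_eq_and_eq_one P.not_le₂₁ P.not_le₁₂ hπ hmax
  have hy : y ∈ P.D := P.mem_D_iff.2 ⟨hy₁.le, hy₂.trans_le hπ.le⟩
  refine ⟨⟨y, hy⟩, le_antisymm ?_ ?_, hy₁, ?_, fun q hq => (hmax q hq).trans_eq hy₂.symm⟩
  · intro d hd
    rw [Ideal.mem_span_singleton]
    refine P.dvd_of_valuation_le ?_ ?_
    · exact (P.valuation₁_le d).trans_eq hy₁.symm
    · exact (hmax _ ((P.mem_N₂_iff d).1 hd)).trans_eq hy₂.symm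
  · rw [Ideal.span_singleton_le_iff_mem, mem_N₂_iff]
    exact hy₂.trans_lt hπ
  · change P.V₂.valuation y ≠ 0
    rw [Valuation.ne_zero_iff]
    rintro rfl
    simp at hy₁

theorem N₁_ne_N₂ : P.N₁ ≠ P.N₂ := by
  obtain ⟨x, hx, hx₂, -⟩ := P.exists_generator_N₁
  intro h
  have : x ∈ P.N₂ := h ▸ hx ▸ Ideal.mem_span_singleton_self x
  rw [mem_N₂_iff, hx₂] at this
  exact lt_irrefl _ this

/-- The product of suitable generators of `N₁` and `N₂` generates `M`, and generates the maximal
ideals of both `V₁` and `V₂`. -/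
theorem exists_generator_M : ∃ m : P.D, P.M = Ideal.span {m} ∧ m ≠ 0 ∧
    (∀ q, P.V₁.valuation q < 1 → P.V₁.valuation q ≤ P.V₁.valuation m) ∧
    ∀ q, P.V₂.valuation q < 1 → P.V₂.valuation q ≤ P.V₂.valuation m := by
  obtain ⟨x, hx, hx₂, hx0, hmax₁⟩ := P.exists_generator_N₁
  obtain ⟨y, hy, hy₁, hy0, hmax₂⟩ := P.exists_generator_N₂
  have hv₁ : P.V₁.valuation ((x * y : P.D) : L) = P.V₁.valuation x := by
    change P.V₁.valuation ((x : L) * y) = _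
    rw [map_mul, hy₁, mul_one]
  have hv₂ : P.V₂.valuation ((x * y : P.D) : L) = P.V₂.valuation y := by
    change P.V₂.valuation ((x : L) * y) = _
    rw [map_mul, hx₂, one_mul]
  refine ⟨x * y, le_antisymm ?_ ?_, ?_, by rwa [hv₁], by rwa [hv₂]⟩
  · rintro d ⟨hd₁, hd₂⟩
    rw [Ideal.mem_span_singleton]
    change d ∈ P.N₁ at hd₁
    rw [hx, Ideal.mem_span_singleton] at hd₁
    obtain ⟨r, rfl⟩ := hd₁
    refine mul_dvd_mul_left _ ?_
    rw [← Ideal.mem_span_singleton, ← hy]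
    refine (P.isPrime_N₂.mem_or_mem hd₂).resolve_left fun h => ?_
    rw [mem_N₂_iff, hx₂] at h
    exact lt_irrefl _ h
  · rw [Ideal.span_singleton_le_iff_mem]
    exact ⟨P.N₁.mul_mem_right _ (hx ▸ Ideal.mem_span_singleton_self x),
      P.N₂.mul_mem_left _ (hy ▸ Ideal.mem_span_singleton_self y)⟩
  · refine mul_ne_zero ?_ ?_
    · rintro rfl
      simp at hx0
    · rintro rfl
      simp at hy0

theorem isMaximal_N₁ : P.N₁.IsMaximal := by
  refine Ideal.isMaximal_iff.2 ⟨(Ideal.ne_top_iff_one _).1 P.isPrime_N₁.ne_top, ?_⟩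
  intro J d hJ hd hdJ
  obtain ⟨c, hc⟩ := P.exists_sub_mem_N₁ d
  have hc0 : c ≠ 0 := by
    rintro rfl
    simp [hd] at hc
  have h : algebraMap k P.D c ∈ J := by
    simpa using J.sub_mem hdJ (hJ hc)
  have h' := J.mul_mem_left (algebraMap k P.D c⁻¹) h
  rwa [← map_mul, inv_mul_cancel₀ hc0, map_one] at h'

theorem isMaximal_N₂ : P.N₂.IsMaximal := by
  refine Ideal.isMaximal_iff.2 ⟨(Ideal.ne_top_iff_one _).1 P.isPrime_N₂.ne_top, ?_⟩
  intro J d hJ hd hdJ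
  obtain ⟨c, hc⟩ := P.exists_sub_mem_N₂ d
  have hc0 : c ≠ 0 := by
    rintro rfl
    simp [hd] at hc
  have h : algebraMap k P.D c ∈ J := by
    simpa using J.sub_mem hdJ (hJ hc)
  have h' := J.mul_mem_left (algebraMap k P.D c⁻¹) h
  rwa [← map_mul, inv_mul_cancel₀ hc0, map_one] at h'

theorem isBezout_D : IsBezout P.D := by
  rw [IsBezout.iff_span_pair_isPrincipal]
  intro a b
  obtain ⟨g, hg, ⟨hVa, hVb⟩, hWa, hWb⟩ := ValuationSubring.exists_common_bound P.V₁ P.V₂ (a : L) b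
  obtain ⟨g', hg', rfl⟩ : ∃ g' ∈ Ideal.span {a, b}, (g' : L) = g := by
    rcases hg with rfl | rfl | rfl
    · exact ⟨a, Ideal.subset_span (by simp), rfl⟩
    · exact ⟨b, Ideal.subset_span (by simp), rfl⟩
    · exact ⟨a + b, Ideal.add_mem _ (Ideal.subset_span (by simp))
        (Ideal.subset_span (by simp)), rfl⟩
  refine ⟨g', le_antisymm ?_ ((Ideal.span_singleton_le_iff_mem _).2 hg')⟩
  rw [Ideal.span_le]
  rintro _ (rfl | rfl)
  · exact Ideal.mem_span_singleton.2 (P.dvd_of_valuation_le hVa hWa)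
  · exact Ideal.mem_span_singleton.2 (P.dvd_of_valuation_le hVb hWb)

theorem le_N₁_or_le_N₂ {I : Ideal P.D} (hI : I ≠ ⊤) : I ≤ P.N₁ ∨ I ≤ P.N₂ := by
  by_contra! hcon
  obtain ⟨a, ha, ha'⟩ := SetLike.not_le_iff_exists.1 hcon.1
  obtain ⟨b, hb, hb'⟩ := SetLike.not_le_iff_exists.1 hcon.2
  obtain ⟨g, hg⟩ := P.isBezout_D.isPrincipal_of_FG (Ideal.span {a, b})
    (Submodule.fg_span (Set.toFinite _))
  change Ideal.span {a, b} = Ideal.span {g} at hg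
  have hga : g ∣ a := Ideal.mem_span_singleton.1 (hg ▸ Ideal.subset_span (by simp))
  have hgb : g ∣ b := Ideal.mem_span_singleton.1 (hg ▸ Ideal.subset_span (by simp))
  have hgI : g ∈ I := by
    have h1 : Ideal.span {a, b} ≤ I := Ideal.span_le.2 (by
      rintro _ (rfl | rfl)
      exacts [ha, hb])
    exact h1 (hg ▸ Ideal.mem_span_singleton_self g)
  refine hI (Ideal.eq_top_of_isUnit_mem _ hgI ((P.isUnit_iff g).2 ⟨fun h => ?_, fun h => ?_⟩))
  · exact ha' (P.N₁.mem_of_dvd hga h)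
  · exact hb' (P.N₂.mem_of_dvd hgb h)

theorem isMaximal_iff (I : Ideal P.D) : I.IsMaximal ↔ I = P.N₁ ∨ I = P.N₂ := by
  constructor
  · intro h
    rcases P.le_N₁_or_le_N₂ h.ne_top with h' | h'
    · exact Or.inl (h.eq_of_le P.isPrime_N₁.ne_top h')
    · exact Or.inr (h.eq_of_le P.isPrime_N₂.ne_top h')
  · rintro (rfl | rfl)
    exacts [P.isMaximal_N₁, P.isMaximal_N₂]

/-- With `g` one of `1`, `z`, `1 + z` having maximal values, `z = (z / g) / (1 / g)`. -/
theorem exists_common_denominator (z : L) : ∃ a s : P.D, (s : L) ≠ 0 ∧ z = a / s ∧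
    (P.V₁.valuation z ≤ 1 → s ∉ P.N₁) ∧ (P.V₂.valuation z ≤ 1 → s ∉ P.N₂) := by
  obtain ⟨g, hg, ⟨hV1, hVz⟩, hW1, hWz⟩ := ValuationSubring.exists_common_bound P.V₁ P.V₂ 1 z
  have hg0 : g ≠ 0 := by
    rintro rfl
    simp at hV1
  have hVg : 0 < P.V₁.valuation g := (Valuation.pos_iff _).2 hg0
  have hWg : 0 < P.V₂.valuation g := (Valuation.pos_iff _).2 hg0
  have hle : ∀ {Γ : Type _} [LinearOrderedCommGroupWithZero Γ] (w : Valuation L Γ),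
      w z ≤ 1 → w g ≤ 1 := by
    intro Γ _ w hw
    rcases hg with rfl | rfl | rfl
    · simp
    · exact hw
    · exact w.map_add_le (by simp) hw
  rw [map_one] at hV1 hW1
  refine ⟨⟨z / g, P.mem_D_iff.2 ⟨?_, ?_⟩⟩, ⟨1 / g, P.mem_D_iff.2 ⟨?_, ?_⟩⟩, ?_, ?_, ?_, ?_⟩
  · rw [map_div₀]; exact (div_le_one₀ hVg).2 hVz
  · rw [map_div₀]; exact (div_le_one₀ hWg).2 hWz
  · rw [map_div₀, map_one]; exact (div_le_one₀ hVg).2 hV1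
  · rw [map_div₀, map_one]; exact (div_le_one₀ hWg).2 hW1
  · simpa using hg0
  · change z = z / g / (1 / g)
    field_simp
  · intro h
    rw [mem_N₁_iff, not_lt]
    change 1 ≤ P.V₁.valuation (1 / g)
    rw [map_div₀, map_one]
    exact (one_le_div₀ hVg).2 (hle _ h)
  · intro h
    rw [mem_N₂_iff, not_lt]
    change 1 ≤ P.V₂.valuation (1 / g)
    rw [map_div₀, map_one]
    exact (one_le_div₀ hWg).2 (hle _ h)

theorem mem_V₁_iff (z : L) : z ∈ P.V₁ ↔ ∃ a s : P.D, s ∉ P.N₁ ∧ z = (a : L) / (s : L) := by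
  constructor
  · intro h
    obtain ⟨a, s, -, e, h1, -⟩ := P.exists_common_denominator z
    exact ⟨a, s, h1 ((P.V₁.valuation_le_one_iff z).2 h), e⟩
  · rintro ⟨a, s, hs, rfl⟩
    rw [mem_N₁_iff, not_lt] at hs
    rw [← P.V₁.valuation_le_one_iff, map_div₀]
    exact (div_le_one₀ (zero_lt_one.trans_le hs)).2 ((P.valuation₁_le a).trans hs)

theorem mem_V₂_iff (z : L) : z ∈ P.V₂ ↔ ∃ a s : P.D, s ∉ P.N₂ ∧ z = (a : L) / (s : L) := by
  constructor
  · intro h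
    obtain ⟨a, s, -, e, -, h2⟩ := P.exists_common_denominator z
    exact ⟨a, s, h2 ((P.V₂.valuation_le_one_iff z).2 h), e⟩
  · rintro ⟨a, s, hs, rfl⟩
    rw [mem_N₂_iff, not_lt] at hs
    rw [← P.V₂.valuation_le_one_iff, map_div₀]
    exact (div_le_one₀ (zero_lt_one.trans_le hs)).2 ((P.valuation₂_le a).trans hs)

theorem isFractionRing_D : IsFractionRing P.D L := by
  refine IsFractionRing.of_field P.D L fun z => ?_
  obtain ⟨a, s, -, e, -⟩ := P.exists_common_denominator z
  exact ⟨a, s, e⟩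

theorem isPruferDomain_D : IsPruferDomain P.D := by
  intro I hI hI0
  obtain ⟨g, rfl⟩ := P.isBezout_D.isPrincipal_of_FG I hI
  have hg : g ≠ 0 := by
    rintro rfl
    simp at hI0
  rw [Ideal.submodule_span_eq, FractionalIdeal.coeIdeal_span_singleton]
  refine IsUnit.of_mul_eq_one
    (FractionalIdeal.spanSingleton _ (algebraMap P.D (FractionRing P.D) g)⁻¹) ?_
  rw [FractionalIdeal.spanSingleton_mul_spanSingleton, mul_inv_cancel₀ (by simpa using hg),
    FractionalIdeal.spanSingleton_one]

end ValuationPair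

/-! ### The ring `R = k + M` and its integral closure -/

namespace ValuationPair

variable {k : Type u} {L : Type v} [Field k] [Field L] [Algebra k L] (P : ValuationPair k L)

theorem mem_R_iff (d : P.D) : d ∈ P.R ↔ ∃ c : k, d - algebraMap k P.D c ∈ P.M := by
  constructor
  · rintro ⟨c, m, hm, rfl⟩
    exact ⟨c, by simpa using hm⟩
  · rintro ⟨c, hc⟩
    exact ⟨c, _, hc, by ring⟩

theorem mem_R_of_mem_M {d : P.D} (hd : d ∈ P.M) : d ∈ P.R :=
  (P.mem_R_iff d).2 ⟨0, by simpa using hd⟩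

theorem mem_MR_iff (r : P.R) : r ∈ P.MR ↔ (r : P.D) ∈ P.M := Iff.rfl

/-- Any element of `D` outside `R` spans `D`, together with `1`, over `k` modulo `M`. -/
theorem exists_eq_algebraMap_add_mul {x : P.D} (hx : x ∉ P.R) (d : P.D) :
    ∃ a b : k, ∃ m ∈ P.M, d = algebraMap k P.D a + algebraMap k P.D b * x + m := by
  obtain ⟨x₁, hx₁⟩ := P.exists_sub_mem_N₁ x
  obtain ⟨x₂, hx₂⟩ := P.exists_sub_mem_N₂ x
  obtain ⟨d₁, hd₁⟩ := P.exists_sub_mem_N₁ d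
  obtain ⟨d₂, hd₂⟩ := P.exists_sub_mem_N₂ d
  have hne : x₁ - x₂ ≠ 0 := by
    intro h
    rw [sub_eq_zero] at h
    subst h
    exact hx ((P.mem_R_iff x).2 ⟨x₁, hx₁, hx₂⟩)
  -- the residues `dᵢ = a + b xᵢ` determine `a` and `b`
  set b := (d₁ - d₂) / (x₁ - x₂) with hb
  have hb' : b * (x₁ - x₂) = d₁ - d₂ := div_mul_cancel₀ _ hne
  refine ⟨d₁ - b * x₁, b, d - (algebraMap k P.D (d₁ - b * x₁) + algebraMap k P.D b * x),
    ⟨?_, ?_⟩, by ring⟩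
  · have h := P.N₁.sub_mem hd₁ (P.N₁.mul_mem_left (algebraMap k P.D b) hx₁)
    have e' : d - (algebraMap k P.D (d₁ - b * x₁) + algebraMap k P.D b * x) =
        d - algebraMap k P.D d₁ - algebraMap k P.D b * (x - algebraMap k P.D x₁) := by
      simp only [map_sub, map_mul]
      ring
    rwa [e']
  · have h := P.N₂.sub_mem hd₂ (P.N₂.mul_mem_left (algebraMap k P.D b) hx₂)
    have e := congrArg (algebraMap k P.D) hb'
    have e' : d - (algebraMap k P.D (d₁ - b * x₁) + algebraMap k P.D b * x) =
        d - algebraMap k P.D d₂ - algebraMap k P.D b * (x - algebraMap k P.D x₂) := by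
      simp only [map_sub, map_mul] at e ⊢
      linear_combination e
    rwa [e']

theorem exists_eq_add_mul {x : P.D} (hx : x ∉ P.R) (d : P.D) :
    ∃ r s : P.R, d = (r : P.D) + x * (s : P.D) := by
  obtain ⟨a, b, m, hm, rfl⟩ := P.exists_eq_algebraMap_add_mul hx d
  refine ⟨⟨algebraMap k P.D a + m, a, m, hm, rfl⟩, algebraMap k P.R b, ?_⟩
  change _ = algebraMap k P.D a + m + x * algebraMap k P.D b
  ring

theorem notMem_R_of_N₁_eq_span {x : P.D} (hx : P.N₁ = Ideal.span {x}) : x ∉ P.R := by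
  intro h
  have hx₁ : x ∈ P.N₁ := hx ▸ Ideal.mem_span_singleton_self x
  have hx₂ : x ∉ P.N₂ := by
    intro h'
    have hle : P.N₁ ≤ P.N₂ := by
      rw [hx]
      exact (Ideal.span_singleton_le_iff_mem _).2 h'
    exact P.N₁_ne_N₂ (P.isMaximal_N₁.eq_of_le P.isPrime_N₂.ne_top hle)
  obtain ⟨c, hc₁, hc₂⟩ := (P.mem_R_iff x).1 h
  have hc : algebraMap k P.D c ∈ P.N₁ := by simpa using P.N₁.sub_mem hx₁ hc₁
  have hc0 : c = 0 := by
    by_contra hc0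
    rw [mem_N₁_iff] at hc
    exact hc.ne (P.valuation₁_algebraMap hc0)
  subst hc0
  exact hx₂ (by simpa using hc₂)

theorem exists_span_pair_eq_top : ∃ a b : P.D, Submodule.span P.R {a, b} = ⊤ := by
  obtain ⟨x, hx, -⟩ := P.exists_generator_N₁
  refine ⟨1, x, eq_top_iff.2 fun d _ => ?_⟩
  obtain ⟨r, s, rfl⟩ := P.exists_eq_add_mul (P.notMem_R_of_N₁_eq_span hx) d
  refine Submodule.mem_span_pair.2 ⟨r, s, ?_⟩
  change (r : P.D) * 1 + (s : P.D) * x = _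
  ring

theorem exists_MR_eq_span_pair : ∃ a b : P.R, P.MR = Ideal.span {a, b} := by
  obtain ⟨x, hx, -⟩ := P.exists_generator_N₁
  obtain ⟨m, hm, -⟩ := P.exists_generator_M
  have hmM : m ∈ P.M := hm ▸ Ideal.mem_span_singleton_self m
  refine ⟨⟨m, P.mem_R_of_mem_M hmM⟩, ⟨m * x, P.mem_R_of_mem_M (P.M.mul_mem_right _ hmM)⟩,
    le_antisymm ?_ ?_⟩
  · intro r hr
    rw [mem_MR_iff, hm, Ideal.mem_span_singleton] at hr
    obtain ⟨d, hd⟩ := hr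
    obtain ⟨a, b, rfl⟩ := P.exists_eq_add_mul (P.notMem_R_of_N₁_eq_span hx) d
    refine Ideal.mem_span_pair.2 ⟨a, b, Subtype.ext ?_⟩
    change (a : P.D) * m + b * (m * x) = r
    rw [hd]; ring
  · rw [Ideal.span_le]
    rintro _ (rfl | rfl)
    · exact hmM
    · exact P.M.mul_mem_right _ hmM

/-- If `x ∈ R` then `x y ∈ R y`; otherwise `D = R + x R`. -/
theorem isQuadraticExtension : IsQuadraticExtension P.R P.D := by
  intro x y
  by_cases hx : x ∈ P.R
  · refine ⟨0, ⟨x, hx⟩, 0, ?_⟩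
    rw [zero_smul, map_zero, zero_add, add_zero]
    rfl
  · obtain ⟨r, s, e⟩ := P.exists_eq_add_mul hx (x * y)
    refine ⟨s, 0, r, ?_⟩
    rw [e, zero_smul, add_zero, add_comm, mul_comm x]
    rfl

theorem isFractionRing_R : IsFractionRing P.R L := by
  -- expand fractions of elements of `D` by a nonzero element of `M`
  have : FaithfulSMul P.R L := by
    rw [faithfulSMul_iff_algebraMap_injective]
    exact Subtype.val_injective.comp Subtype.val_injective
  refine IsFractionRing.of_field P.R L fun z => ?_
  obtain ⟨a, s, -, e, -⟩ := P.exists_common_denominator z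
  obtain ⟨m, hm, hm0, -⟩ := P.exists_generator_M
  have hmM : m ∈ P.M := hm ▸ Ideal.mem_span_singleton_self m
  refine ⟨⟨a * m, P.mem_R_of_mem_M (P.M.mul_mem_left _ hmM)⟩,
    ⟨s * m, P.mem_R_of_mem_M (P.M.mul_mem_left _ hmM)⟩, ?_⟩
  change z = (a : L) * m / (s * m)
  rw [mul_div_mul_right _ _ (by simpa using hm0), e]

-- Shortcut instances: the algebra structures involved go through several subalgebras.

instance isScalarTower_R_R_D : IsScalarTower P.R P.R P.D := IsScalarTower.left _

instance isScalarTower_R_R_L : IsScalarTower P.R P.R L := IsScalarTower.left _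

instance moduleFinite_R_D : Module.Finite P.R P.D := by
  obtain ⟨a, b, h⟩ := P.exists_span_pair_eq_top
  exact ⟨h ▸ Submodule.fg_span (Set.toFinite _)⟩

instance isIntegral_R_D : Algebra.IsIntegral P.R P.D := Algebra.IsIntegral.of_finite _ _

theorem isIntegral_iff (x : L) : IsIntegral P.R x ↔ x ∈ P.D := by
  constructor
  · intro h
    refine ⟨?_, ?_⟩
    · obtain ⟨p, hp, h0⟩ := h
      have h' : IsIntegral P.V₁ x := by
        refine ⟨p.map (P.incl₁.comp (algebraMap P.R P.D)), hp.map _, ?_⟩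
        rw [Polynomial.eval₂_map]
        exact h0
      obtain ⟨y, rfl⟩ := IsIntegrallyClosed.isIntegral_iff.1 h'
      exact y.2
    · obtain ⟨p, hp, h0⟩ := h
      have h' : IsIntegral P.V₂ x := by
        refine ⟨p.map (P.incl₂.comp (algebraMap P.R P.D)), hp.map _, ?_⟩
        rw [Polynomial.eval₂_map]
        exact h0
      obtain ⟨y, rfl⟩ := IsIntegrallyClosed.isIntegral_iff.1 h'
      exact y.2
  · intro h
    exact (Algebra.IsIntegral.isIntegral (R := P.R) (⟨x, h⟩ : P.D)).map
      (IsScalarTower.toAlgHom P.R P.D L)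

theorem mem_D_iff_mul_M (t : L) :
    t ∈ P.D ↔ ∀ m ∈ P.M, ∃ m' ∈ P.M, t * (m : L) = (m' : L) := by
  constructor
  · intro ht m hm
    exact ⟨⟨t, ht⟩ * m, P.M.mul_mem_left _ hm, rfl⟩
  · intro h
    obtain ⟨m, hm, hm0, -⟩ := P.exists_generator_M
    obtain ⟨m', hm', e⟩ := h m (hm ▸ Ideal.mem_span_singleton_self m)
    rw [hm, Ideal.mem_span_singleton] at hm'
    obtain ⟨d, rfl⟩ := hm'
    have : t = d := mul_right_cancel₀ (b := (m : L)) (by simpa using hm0) (by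
      rw [e, mul_comm (d : L)]; rfl)
    exact this ▸ d.2

theorem isUnit_R_iff (r : P.R) : IsUnit r ↔ r ∉ P.MR := by
  constructor
  · intro h hr
    have h1 := h.map (algebraMap P.R P.D)
    exact P.isPrime_N₁.ne_top (Ideal.eq_top_of_isUnit_mem _ ((P.mem_MR_iff r).1 hr).1 h1)
  · intro h
    obtain ⟨d, hd⟩ := r
    rw [mem_MR_iff] at h
    change d ∉ P.M at h
    obtain ⟨c, m, hm, rfl⟩ := id hd
    have hc0 : c ≠ 0 := by
      rintro rfl
      simp [hm] at h
    have hcc : algebraMap k P.D c * algebraMap k P.D c⁻¹ = 1 := by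
      rw [← map_mul, mul_inv_cancel₀ hc0, map_one]
    have hu : IsUnit (algebraMap k P.D c + m) := by
      refine (P.isUnit_iff _).2 ⟨fun h' => ?_, fun h' => ?_⟩
      · have h1 : algebraMap k P.D c ∈ P.N₁ := by simpa using P.N₁.sub_mem h' hm.1
        exact ((P.mem_N₁_iff _).1 h1).ne (P.valuation₁_algebraMap hc0)
      · have h1 : algebraMap k P.D c ∈ P.N₂ := by simpa using P.N₂.sub_mem h' hm.2
        exact ((P.mem_N₂_iff _).1 h1).ne (P.valuation₂_algebraMap hc0)
    obtain ⟨e, he⟩ := hu.exists_right_inv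
    have heR : e ∈ P.R := by
      refine ⟨c⁻¹, -(algebraMap k P.D c⁻¹ * e * m), P.M.neg_mem (P.M.mul_mem_left _ hm), ?_⟩
      linear_combination -e * hcc + algebraMap k P.D c⁻¹ * he
    exact IsUnit.of_mul_eq_one (⟨e, heR⟩ : P.R) (Subtype.ext he)

theorem MR_isMaximal_iff (I : Ideal P.R) : I.IsMaximal ↔ I = P.MR := by
  have hne : P.MR ≠ ⊤ := by
    rw [Ideal.ne_top_iff_one, ← isUnit_R_iff]
    exact isUnit_one
  have hle : ∀ J : Ideal P.R, J ≠ ⊤ → J ≤ P.MR := by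
    intro J hJ r hr
    by_contra h
    exact hJ (Ideal.eq_top_of_isUnit_mem _ hr ((P.isUnit_R_iff r).2 h))
  constructor
  · intro h
    exact h.eq_of_le hne (hle I h.ne_top)
  · rintro rfl
    refine ⟨hne, fun J hJ => ?_⟩
    by_contra h
    exact absurd (hle J h) (not_le_of_gt hJ)

instance isLocalRing_R : IsLocalRing P.R :=
  IsLocalRing.of_unique_max_ideal ⟨P.MR, (P.MR_isMaximal_iff _).2 rfl,
    fun I hI => (P.MR_isMaximal_iff I).1 hI⟩

end ValuationPair

/-! ### Reductions and multipliers of a subspace at a valuation -/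

section ValuationBound

variable {k : Type u} {L : Type v} [Field k] [Field L] [Algebra k L] (V : ValuationSubring L)

/-- The elements `t` of `L` such that `t S ⊆ m S V`. For `m = 1` this is the ring of multipliers
of the `V`-module generated by `S`. -/
def ValuationSubring.multipliers (S : Submodule k L) (m : L) : AddSubgroup L where
  carrier := {t | ∀ f ∈ S, ∃ g ∈ S, V.valuation (t * f) ≤ V.valuation (m * g)}
  zero_mem' := fun f hf => ⟨f, hf, by simp⟩
  neg_mem' := by
    intro t ht f hf
    obtain ⟨g, hg, h⟩ := ht f hf
    exact ⟨g, hg, by rwa [neg_mul, Valuation.map_neg]⟩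
  add_mem' := by
    intro t t' ht ht' f hf
    obtain ⟨g, hg, h⟩ := ht f hf
    obtain ⟨g', hg', h'⟩ := ht' f hf
    rw [add_mul]
    rcases le_total (V.valuation (m * g)) (V.valuation (m * g')) with hle | hle
    · exact ⟨g', hg', Valuation.map_add_le _ (h.trans hle) h'⟩
    · exact ⟨g, hg, Valuation.map_add_le _ h (h'.trans hle)⟩

variable {V} {S : Submodule k L}

theorem ValuationSubring.mul_mem_multipliers {m n t e : L} (ht : t ∈ V.multipliers S m)
    (he : e ∈ V.multipliers S n) : t * e ∈ V.multipliers S (m * n) := by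
  intro f hf
  obtain ⟨g, hg, h⟩ := he f hf
  obtain ⟨g', hg', h'⟩ := ht g hg
  refine ⟨g', hg', ?_⟩
  simp only [map_mul] at h h' ⊢
  calc V.valuation t * V.valuation e * V.valuation f
      = V.valuation t * (V.valuation e * V.valuation f) := mul_assoc _ _ _
    _ ≤ V.valuation t * (V.valuation n * V.valuation g) := by gcongr
    _ = V.valuation n * (V.valuation t * V.valuation g) := by ac_rfl
    _ ≤ V.valuation n * (V.valuation m * V.valuation g') := by gcongr
    _ = V.valuation m * V.valuation n * V.valuation g' := by ac_rfl

theorem ValuationSubring.mem_multipliers_of_le {m t : L} (h : V.valuation t ≤ V.valuation m) :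
    t ∈ V.multipliers S m :=
  fun f hf => ⟨f, hf, by rw [map_mul, map_mul]; gcongr⟩

/-- Modulo `m`, where `m` generates the maximal ideal of `V`, every multiplier is congruent to a
constant. If the multiplier `e` is not in `V`, then `m` is invertible in the ring of
multipliers, and `e` is congruent to `0`. -/
theorem ValuationSubring.exists_sub_mem_multipliers {m e : L}
    (hmax : ∀ q, V.valuation q < 1 → V.valuation q ≤ V.valuation m)
    (hres : ∀ z, V.valuation z ≤ 1 → ∃ c : k, V.valuation (z - algebraMap k L c) < 1)
    (he : e ∈ V.multipliers S 1) : ∃ c : k, e - algebraMap k L c ∈ V.multipliers S m := by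
  rcases le_or_gt (V.valuation e) 1 with h | h
  · obtain ⟨c, hc⟩ := hres e h
    exact ⟨c, mem_multipliers_of_le (hmax _ hc)⟩
  · refine ⟨0, ?_⟩
    rw [map_zero, sub_zero]
    have he0 : e ≠ 0 := by
      rintro rfl
      simp at h
    have h1 : V.valuation e⁻¹ ≤ V.valuation m := by
      refine hmax _ ?_
      rw [map_inv₀]
      exact (inv_lt_one₀ (zero_lt_one.trans h)).2 h
    have h2 := mul_mem_multipliers (mem_multipliers_of_le h1) (mul_mem_multipliers he he)
    rwa [inv_mul_cancel_left₀ he0, mul_one, mul_one] at h2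

variable (V S) in
/-- The product of the `V`-module generated by `S` with itself is contained in `w` times it. -/
def ValuationSubring.IsReduction (w : L) : Prop :=
  ∀ b ∈ S, ∀ c ∈ S, ∃ d ∈ S, V.valuation (b * c) ≤ V.valuation (w * d)

theorem ValuationSubring.IsReduction.of_le {a w : L} (ha : V.IsReduction S a)
    (h : V.valuation a ≤ V.valuation w) : V.IsReduction S w := by
  intro b hb c hc
  obtain ⟨d, hd, h'⟩ := ha b hb c hc
  refine ⟨d, hd, h'.trans ?_⟩
  rw [map_mul, map_mul]
  gcongr

theorem ValuationSubring.IsReduction.ne_zero {w : L} (hw : V.IsReduction S w) (hS : S ≠ ⊥) :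
    w ≠ 0 := by
  rintro rfl
  obtain ⟨z, hz, hz0⟩ := Submodule.exists_mem_ne_zero_of_ne_bot hS
  obtain ⟨d, -, h⟩ := hw z hz z hz
  simp [hz0] at h

theorem ValuationSubring.IsReduction.div_mem_multipliers {w b : L} (hw : V.IsReduction S w)
    (hb : b ∈ S) : b / w ∈ V.multipliers S 1 := by
  intro c hc
  obtain ⟨d, hd, h⟩ := hw b hb c hc
  refine ⟨d, hd, ?_⟩
  rw [one_mul, div_mul_eq_mul_div, map_div₀]
  rw [map_mul _ w d, mul_comm (V.valuation w)] at h
  exact div_le_of_le_mul₀ zero_le zero_le h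

/-- Reductions at two valuations can be chosen to agree, as one of `a`, `b`, `a + b`. -/
theorem ValuationSubring.exists_isReduction {V W : ValuationSubring L} {a b : L}
    (ha : a ∈ S) (hb : b ∈ S) (hVa : V.IsReduction S a) (hWb : W.IsReduction S b) :
    ∃ w ∈ S, V.IsReduction S w ∧ W.IsReduction S w := by
  rcases le_or_gt (V.valuation a) (V.valuation b) with h | h
  · exact ⟨b, hb, hVa.of_le h, hWb⟩
  rcases le_or_gt (W.valuation b) (W.valuation a) with h' | h'
  · exact ⟨a, ha, hVa, hWb.of_le h'⟩
  refine ⟨a + b, S.add_mem ha hb, hVa.of_le ?_, hWb.of_le ?_⟩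
  · rw [Valuation.map_add_eq_of_lt_left _ h]
  · rw [Valuation.map_add_eq_of_lt_right _ h']

theorem ValuationSubring.exists_isReduction_of_isStronglyDiscrete (hV : IsStronglyDiscrete V)
    (hS : S ≠ ⊥) (hSV : ∀ s ∈ S, s ∈ V) : ∃ w ∈ S, V.IsReduction S w := by
  -- the ideal of `V` generated by `S`
  let J : Ideal V :=
    { carrier := {z | ∃ s ∈ S, V.valuation z ≤ V.valuation s}
      zero_mem' := ⟨0, S.zero_mem, by simp⟩
      add_mem' := by
        rintro a b ⟨s, hs, h⟩ ⟨t, ht, h'⟩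
        rcases le_total (V.valuation s) (V.valuation t) with hle | hle
        · exact ⟨t, ht, Valuation.map_add_le _ (h.trans hle) h'⟩
        · exact ⟨s, hs, Valuation.map_add_le _ h (h'.trans hle)⟩
      smul_mem' := by
        rintro r a ⟨s, hs, h⟩
        refine ⟨s, hs, ?_⟩
        change V.valuation (r * a) ≤ _
        rw [map_mul]
        exact (mul_le_of_le_one_left zero_le (V.valuation_le_one r)).trans h }
  have hJ : J ≠ ⊥ := by
    obtain ⟨z, hz, hz0⟩ := Submodule.exists_mem_ne_zero_of_ne_bot hS
    intro h
    have h1 : (⟨z, hSV z hz⟩ : V) ∈ J := ⟨z, hz, le_rfl⟩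
    rw [h, Ideal.mem_bot] at h1
    exact hz0 (congrArg Subtype.val h1)
  obtain ⟨a, ⟨w, hw, haw⟩, h⟩ := exists_mul_dvd_of_isStronglyDiscrete hV J hJ
  refine ⟨w, hw, fun b hb c hc => ?_⟩
  obtain ⟨d, ⟨s, hs, hds⟩, e⟩ := h ⟨b, hSV b hb⟩ ⟨b, hb, le_rfl⟩ ⟨c, hSV c hc⟩ ⟨c, hc, le_rfl⟩
  refine ⟨s, hs, ?_⟩
  have e' : b * c = a * d := congrArg Subtype.val e
  rw [e', map_mul, map_mul]
  gcongr

end ValuationBound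

/-! ### Ideals of rings between `M` and `D` -/

namespace ValuationPair

variable {k : Type u} {L : Type v} [Field k] [Field L] [Algebra k L] (P : ValuationPair k L)

/-- If `S` is stable under multiplication by `M` and `w ∈ S` is a reduction of `S` for both
valuations, then `S² ⊆ w S`. Indeed, with `E` the ring of common multipliers of `V₁ S` and `V₂ S`,
`w⁻¹ S` lies between `M E` and `E`, and `E / M E` embeds in `k × k`. -/
theorem exists_mul_eq_of_isReduction {S : Submodule k L}
    (hS : ∀ μ : P.D, μ ∈ P.M → ∀ s ∈ S, (μ : L) * s ∈ S) {w : L} (hw : w ∈ S) (hw0 : w ≠ 0)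
    (h₁ : P.V₁.IsReduction S w) (h₂ : P.V₂.IsReduction S w) {b c : L} (hb : b ∈ S) (hc : c ∈ S) :
    ∃ d ∈ S, b * c = w * d := by
  obtain ⟨m, hm, hm0, hmax₁, hmax₂⟩ := P.exists_generator_M
  have hmM : m ∈ P.M := hm ▸ Ideal.mem_span_singleton_self m
  -- elements of `m E` become elements of `S` after multiplication by `w`
  have hmem : ∀ t : L, t ∈ P.V₁.multipliers S m → t ∈ P.V₂.multipliers S m → t * w ∈ S := by
    intro t ht₁ ht₂
    obtain ⟨g₁, hg₁, hle₁⟩ := ht₁ w hw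
    obtain ⟨g₂, hg₂, hle₂⟩ := ht₂ w hw
    obtain ⟨α, β, hα, hβ, e⟩ := ValuationSubring.exists_eq_mul_add_mul hle₁ hle₂
    have e' : t * w = (m * α) * g₁ + (m * β) * g₂ := by
      rw [e]; ring
    rw [e']
    exact S.add_mem (hS (m * ⟨α, hα⟩) (P.M.mul_mem_right _ hmM) g₁ hg₁)
      (hS (m * ⟨β, hβ⟩) (P.M.mul_mem_right _ hmM) g₂ hg₂)
  have hconst : ∀ a : k, algebraMap k L a ∈ P.V₁.multipliers S 1 ∧
      algebraMap k L a ∈ P.V₂.multipliers S 1 := fun a =>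
    ⟨ValuationSubring.mem_multipliers_of_le (by
      rw [map_one]; exact (P.V₁.valuation_le_one_iff _).2 (P.mem₁ a)),
    ValuationSubring.mem_multipliers_of_le (by
      rw [map_one]; exact (P.V₂.valuation_le_one_iff _).2 (P.mem₂ a))⟩
  have hsmul : ∀ (a : k) (s : L), s ∈ S → algebraMap k L a * s ∈ S := fun a s hs => by
    rw [← Algebra.smul_def]
    exact S.smul_mem a hs
  have hres₁ : ∀ e ∈ P.V₁.multipliers S 1,
      ∃ c : k, e - algebraMap k L c ∈ P.V₁.multipliers S m := fun e he =>
    ValuationSubring.exists_sub_mem_multipliers hmax₁ (fun z => P.exists_residue₁) he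
  have hres₂ : ∀ e ∈ P.V₂.multipliers S 1,
      ∃ c : k, e - algebraMap k L c ∈ P.V₂.multipliers S m := fun e he =>
    ValuationSubring.exists_sub_mem_multipliers hmax₂ (fun z => P.exists_residue₂) he
  have hb₁ := h₁.div_mem_multipliers hb
  have hb₂ := h₂.div_mem_multipliers hb
  have hc₁ := h₁.div_mem_multipliers hc
  have hc₂ := h₂.div_mem_multipliers hc
  obtain ⟨p₁, hp₁⟩ := hres₁ _ hb₁
  obtain ⟨p₂, hp₂⟩ := hres₂ _ hb₂
  suffices h : (b / w * (c / w)) * w ∈ S by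
    refine ⟨_, h, ?_⟩
    field_simp
  by_cases hp : p₁ = p₂
  · -- `b / w` is constant modulo `m E`
    subst hp
    have e : b / w * (c / w) * w =
        algebraMap k L p₁ * c + ((b / w - algebraMap k L p₁) * (c / w)) * w := by
      field_simp
      ring
    rw [e]
    refine S.add_mem (hsmul _ _ hc) (hmem _ ?_ ?_)
    · simpa using ValuationSubring.mul_mem_multipliers hp₁ hc₁
    · simpa using ValuationSubring.mul_mem_multipliers hp₂ hc₂
  · -- `w⁻¹ S` contains an element with residues `0` and `1`, so that `w⁻¹ S = E`
    have hp' : p₂ - p₁ ≠ 0 := sub_ne_zero.2 (Ne.symm hp)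
    have hpL : algebraMap k L p₂ - algebraMap k L p₁ ≠ 0 := by
      simpa [sub_eq_zero] using Ne.symm hp
    set σ : L := algebraMap k L (p₂ - p₁)⁻¹ * (b / w - algebraMap k L p₁) with hσ
    have hσ₁ : σ ∈ P.V₁.multipliers S m := by
      simpa using ValuationSubring.mul_mem_multipliers (hconst _).1 hp₁
    have hσ₂ : 1 - σ ∈ P.V₂.multipliers S m := by
      have h := ValuationSubring.mul_mem_multipliers (hconst (-(p₂ - p₁)⁻¹)).2 hp₂
      rw [one_mul] at h
      convert h using 1
      rw [hσ]
      simp only [map_neg, map_inv₀, map_sub]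
      field_simp
      ring
    have hσS : σ * w ∈ S := by
      have e : σ * w = algebraMap k L (p₂ - p₁)⁻¹ * (b - algebraMap k L p₁ * w) := by
        rw [hσ]
        field_simp
      rw [e]
      exact hsmul _ _ (S.sub_mem hb (hsmul _ _ hw))
    have he₁ := ValuationSubring.mul_mem_multipliers hb₁ hc₁
    have he₂ := ValuationSubring.mul_mem_multipliers hb₂ hc₂
    rw [one_mul] at he₁ he₂
    obtain ⟨q₁, hq₁⟩ := hres₁ _ he₁
    obtain ⟨q₂, hq₂⟩ := hres₂ _ he₂
    -- `t` has both residues `0`, and differs from `f` by an element of `w⁻¹ S`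
    set f : L := b / w * (c / w) with hf
    set t : L := f - algebraMap k L q₁ + algebraMap k L (q₁ - q₂) * σ with ht
    have ht₁ : t ∈ P.V₁.multipliers S m := by
      refine AddSubgroup.add_mem _ hq₁ ?_
      simpa using ValuationSubring.mul_mem_multipliers (hconst (q₁ - q₂)).1 hσ₁
    have ht₂ : t ∈ P.V₂.multipliers S m := by
      have h := ValuationSubring.mul_mem_multipliers (hconst (q₁ - q₂)).2 hσ₂
      rw [one_mul] at h
      have e : t = f - algebraMap k L q₂ - algebraMap k L (q₁ - q₂) * (1 - σ) := by
        rw [ht, map_sub]; ring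
      rw [e]
      exact AddSubgroup.sub_mem _ hq₂ h
    have e : f * w = t * w + algebraMap k L q₁ * w - algebraMap k L (q₁ - q₂) * (σ * w) := by
      rw [ht]; ring
    rw [e]
    exact S.sub_mem (S.add_mem (hmem t ht₁ ht₂) (hsmul _ _ hw)) (hsmul _ _ hσS)

section Stable

variable {A : Type v} [CommRing A] [Algebra k A] (φ : A →ₐ[k] L)

theorem isStableIdeal_of_isReduction [IsDomain A] (hφ : Function.Injective φ)
    (hφM : ∀ μ : P.D, μ ∈ P.M → ∃ a, φ a = μ) {I : Ideal A} (hI : I ≠ ⊥)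
    (h₁ : ∃ w ∈ (I.restrictScalars k).map φ.toLinearMap,
      P.V₁.IsReduction ((I.restrictScalars k).map φ.toLinearMap) w)
    (h₂ : ∃ w ∈ (I.restrictScalars k).map φ.toLinearMap,
      P.V₂.IsReduction ((I.restrictScalars k).map φ.toLinearMap) w) : IsStableIdeal I := by
  obtain ⟨a, ha, ha'⟩ := h₁
  obtain ⟨b, hb, hb'⟩ := h₂
  obtain ⟨w, hw, hw₁, hw₂⟩ := ValuationSubring.exists_isReduction ha hb ha' hb'
  set S := (I.restrictScalars k).map φ.toLinearMap with hS
  have hmem : ∀ i ∈ I, φ i ∈ S := fun i hi => ⟨i, hi, rfl⟩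
  have hS0 : S ≠ ⊥ := by
    obtain ⟨z, hz, hz0⟩ := Submodule.exists_mem_ne_zero_of_ne_bot hI
    refine (Submodule.ne_bot_iff _).2 ⟨φ z, hmem z hz, ?_⟩
    rwa [Ne, map_eq_zero_iff φ hφ]
  have hw0 := hw₁.ne_zero hS0
  obtain ⟨w, hwI, rfl⟩ := hw
  refine isStableIdeal_of_mul_eq I w hwI (fun h => hw0 (by rw [h, map_zero])) ?_
  intro b hb c hc
  have hSM : ∀ μ : P.D, μ ∈ P.M → ∀ s ∈ S, (μ : L) * s ∈ S := by
    rintro μ hμ _ ⟨i, hi, rfl⟩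
    obtain ⟨a, ha⟩ := hφM μ hμ
    rw [← ha]
    exact ⟨a * i, I.mul_mem_left _ hi, map_mul φ a i⟩
  obtain ⟨_, ⟨d, hd, rfl⟩, e⟩ := P.exists_mul_eq_of_isReduction hSM (hmem w hwI) hw0 hw₁ hw₂
    (hmem b hb) (hmem c hc)
  refine ⟨d, hd, hφ ?_⟩
  rw [map_mul, map_mul]
  exact e

/-- Among finitely many generators, one of maximal value is a reduction. -/
theorem exists_isReduction_of_fg (V : ValuationSubring L) (hφV : ∀ a, φ a ∈ V) {I : Ideal A}
    (hI : I.FG) : ∃ w ∈ (I.restrictScalars k).map φ.toLinearMap,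
      V.IsReduction ((I.restrictScalars k).map φ.toLinearMap) w := by
  obtain ⟨t, rfl⟩ := hI
  have hmax : ∃ w ∈ Ideal.span (t : Set A), ∀ b ∈ t, V.valuation (φ b) ≤ V.valuation (φ w) := by
    rcases t.eq_empty_or_nonempty with rfl | ht
    · exact ⟨0, zero_mem _, by simp⟩
    · obtain ⟨w, hw, h⟩ := t.exists_max_image (fun b => V.valuation (φ b)) ht
      exact ⟨w, Ideal.subset_span hw, h⟩
  obtain ⟨w, hw, h⟩ := hmax
  have hle : ∀ b ∈ Ideal.span (t : Set A), V.valuation (φ b) ≤ V.valuation (φ w) := by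
    intro b hb
    refine Submodule.span_induction (fun b hb => h b hb) (by simp) ?_ ?_ hb
    · intro x y _ _ hx hy
      rw [map_add]
      exact Valuation.map_add_le _ hx hy
    · intro a x _ hx
      rw [smul_eq_mul, map_mul, map_mul]
      exact (mul_le_of_le_one_left zero_le ((V.valuation_le_one_iff _).2 (hφV a))).trans hx
  refine ⟨φ w, ⟨w, hw, rfl⟩, ?_⟩
  rintro _ ⟨b, hb, rfl⟩ _ ⟨c, hc, rfl⟩
  refine ⟨φ c, ⟨c, hc, rfl⟩, ?_⟩
  rw [map_mul, map_mul]
  have := hle b hb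
  change V.valuation (φ b) * V.valuation (φ c) ≤ _
  gcongr

theorem isFinitelyStableDomain_of_algHom [IsDomain A] (hφ : Function.Injective φ)
    (hφD : ∀ a, φ a ∈ P.D) (hφM : ∀ μ : P.D, μ ∈ P.M → ∃ a, φ a = μ) :
    IsFinitelyStableDomain A := fun _ hfg hI =>
  P.isStableIdeal_of_isReduction φ hφ hφM hI
    (exists_isReduction_of_fg φ P.V₁ (fun a => (hφD a).1) hfg)
    (exists_isReduction_of_fg φ P.V₂ (fun a => (hφD a).2) hfg)

theorem isStableRing_of_algHom [IsDomain A] (hφ : Function.Injective φ) (hφD : ∀ a, φ a ∈ P.D)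
    (hφM : ∀ μ : P.D, μ ∈ P.M → ∃ a, φ a = μ) (h₁ : IsStronglyDiscrete P.V₁)
    (h₂ : IsStronglyDiscrete P.V₂) : IsStableRing A := by
  intro I hI
  have hS0 : (I.restrictScalars k).map φ.toLinearMap ≠ ⊥ := by
    obtain ⟨z, hz, hz0⟩ := Submodule.exists_mem_ne_zero_of_ne_bot hI
    refine (Submodule.ne_bot_iff _).2 ⟨φ z, ⟨z, hz, rfl⟩, ?_⟩
    rwa [Ne, map_eq_zero_iff φ hφ]
  refine P.isStableIdeal_of_isReduction φ hφ hφM hI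
    (ValuationSubring.exists_isReduction_of_isStronglyDiscrete h₁ hS0 ?_)
    (ValuationSubring.exists_isReduction_of_isStronglyDiscrete h₂ hS0 ?_)
  · rintro _ ⟨a, -, rfl⟩
    exact (hφD a).1
  · rintro _ ⟨a, -, rfl⟩
    exact (hφD a).2

end Stable

end ValuationPair

/-! ### One-dimensional rings, chain conditions, and transport along isomorphisms -/

theorem IsStronglyDiscrete.of_isPrincipalIdealRing (R : Type u) [CommRing R] [IsDomain R]
    [IsPrincipalIdealRing R] : IsStronglyDiscrete R :=
  (IsStableRing.of_isPrincipalIdealRing R).isStronglyDiscrete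

theorem Ring.KrullDimLE.of_ringKrullDim_eq_one {A : Type u} [CommRing A]
    (h : ringKrullDim A = 1) : Ring.KrullDimLE 1 A :=
  Ring.krullDimLE_iff.2 (by simp [h])

theorem isDiscreteValuationRing_of_ringKrullDim_eq_one {V : Type u} [CommRing V] [IsDomain V]
    [IsLocalRing V] (hV : (IsLocalRing.maximalIdeal V).IsPrincipal) (h : ringKrullDim V = 1) :
    IsDiscreteValuationRing V := by
  have hdim := Ring.krullDimLE_one_iff_of_noZeroDivisors.1 (.of_ringKrullDim_eq_one h)
  have hfield := (ringKrullDim_eq_one_iff_of_isLocalRing_isDomain.1 h).1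
  have : IsPrincipalIdealRing V := by
    refine IsPrincipalIdealRing.of_prime fun I hI => ?_
    by_cases h0 : I = ⊥
    · exact h0 ▸ ⟨0, by simp⟩
    · rwa [IsLocalRing.eq_maximalIdeal (hdim I h0 hI)]
  exact { not_a_field' := fun h0 => hfield (IsLocalRing.isField_iff_maximalIdeal_eq.2 h0) }

theorem isArchimedeanDomain_of_ringKrullDim_eq_one {A : Type u} {V : Type v} [CommRing A]
    [CommRing V] [IsDomain V] [IsLocalRing V] (φ : A →+* V) (hφ : Function.Injective φ)
    [IsLocalHom φ] (h : ringKrullDim V = 1) : IsArchimedeanDomain A := by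
  intro r hr
  rw [eq_bot_iff]
  intro z hz
  rw [Ideal.mem_iInf] at hz
  rw [Ideal.mem_bot]
  by_contra hz0
  have hz0' : φ z ≠ 0 := by rwa [Ne, map_eq_zero_iff φ hφ]
  have hrV : φ r ∈ IsLocalRing.maximalIdeal V := fun h' => hr (isUnit_of_map_unit φ r h')
  obtain ⟨n, hn⟩ := (ringKrullDim_eq_one_iff_of_isLocalRing_isDomain.1 h).2 _ hz0' hrV
  obtain ⟨a, ha⟩ := Ideal.mem_span_singleton.1 hn
  obtain ⟨b, rfl⟩ := Ideal.mem_span_singleton.1 (hz (n + 1))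
  have hr0 : φ r ^ n ≠ 0 := by
    intro h0
    rw [map_mul, map_pow, pow_succ, h0, zero_mul, zero_mul] at hz0'
    exact hz0' rfl
  rw [map_mul, map_pow] at ha
  have h1 : φ r * (φ b * a) = 1 := mul_left_cancel₀ hr0 (by linear_combination -ha)
  exact hrV (IsUnit.of_mul_eq_one _ h1)

/-- A chain of principal ideals of `A` becomes stationary in `V`; by locality, the quotients of
the generators are then units of `A`. -/
theorem satisfiesACCP_of_isLocalHom {A : Type u} {V : Type v} [CommRing A] [IsDomain A]
    [CommRing V] [IsDomain V] [IsNoetherianRing V] (φ : A →+* V) (hφ : Function.Injective φ)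
    [IsLocalHom φ] : SatisfiesACCP A := by
  intro f hf
  choose a ha using fun n => (hf n).principal
  simp only [Ideal.submodule_span_eq] at ha
  have hdvd : ∀ n m, n ≤ m → a m ∣ a n := by
    intro n m h
    rw [← Ideal.span_singleton_le_span_singleton, ← ha, ← ha]
    exact f.monotone h
  let g : ℕ →o Ideal V :=
    ⟨fun n => Ideal.span {φ (a n)}, fun n m h =>
      Ideal.span_singleton_le_span_singleton.2 (map_dvd φ (hdvd n m h))⟩
  obtain ⟨n, hn⟩ := monotone_stabilizes_iff_noetherian.2 ‹IsNoetherianRing V› g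
  refine ⟨n, fun m hm => ?_⟩
  rw [ha, ha]
  obtain ⟨r, hr⟩ := hdvd n m hm
  have h1 : φ (a n) ∣ φ (a m) := by
    rw [← Ideal.span_singleton_le_span_singleton]
    exact (hn m hm).ge
  by_cases h0 : a m = 0
  · rw [hr, h0, zero_mul]
  · have h0' : φ (a m) ≠ 0 := by rwa [Ne, map_eq_zero_iff φ hφ]
    obtain ⟨s, hs⟩ := h1
    rw [hr, map_mul] at hs
    have h2 : φ r * s = 1 := mul_left_cancel₀ h0' (by linear_combination -hs)
    have hu : IsUnit r := isUnit_of_map_unit φ r (IsUnit.of_mul_eq_one _ h2)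
    rw [hr]
    exact Ideal.span_singleton_mul_right_unit hu _

theorem IsArchimedeanDomain.of_ringEquiv {A : Type u} {B : Type v} [CommRing A] [CommRing B]
    (e : A ≃+* B) (h : IsArchimedeanDomain A) : IsArchimedeanDomain B := by
  intro r hr
  rw [eq_bot_iff]
  intro z hz
  rw [Ideal.mem_iInf] at hz
  have h1 : e.symm z ∈ ⨅ n : ℕ, Ideal.span {e.symm r ^ n} := by
    rw [Ideal.mem_iInf]
    intro n
    have := map_dvd e.symm (Ideal.mem_span_singleton.1 (hz n))
    rw [map_pow] at this
    exact Ideal.mem_span_singleton.2 this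
  rw [h _ (by simpa using hr), Ideal.mem_bot] at h1
  simpa using h1

theorem Algebra.HasGoingDown.of_algEquiv {R : Type u} {A : Type v} {B : Type w} [CommRing R]
    [CommRing A] [CommRing B] [Algebra R A] [Algebra R B] (e : A ≃ₐ[R] B)
    [Algebra.HasGoingDown R A] : Algebra.HasGoingDown R B := by
  let : Algebra A B := e.toRingHom.toAlgebra
  have : IsScalarTower R A B := IsScalarTower.of_algebraMap_eq fun r => (e.commutes r).symm
  have : Module.Flat A B := by
    let f : A ≃ₗ[A] B :=
      { e.toEquiv with
        map_add' := map_add e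
        map_smul' := fun a b => map_mul e a b }
    exact Module.Flat.of_linearEquiv f.symm
  exact Algebra.HasGoingDown.trans R A B

/-- Chains of primes lift along integral extensions, by lying over and going up. -/
theorem exists_ltSeries_of_isIntegral {R : Type u} {S : Type v} [CommRing R] [CommRing S]
    [Algebra R S] [Algebra.IsIntegral R S] [FaithfulSMul R S] (l : LTSeries (PrimeSpectrum R)) :
    ∃ l' : LTSeries (PrimeSpectrum S), l'.length = l.length ∧
      PrimeSpectrum.comap (algebraMap R S) l'.last = l.last := by
  induction l using RelSeries.inductionOn' with
  | singleton p =>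
    obtain ⟨Q, -, hQ, h⟩ := Ideal.exists_ideal_over_prime_of_isIntegral (S := S) p.asIdeal ⊥ (by
      rw [Ideal.comap_bot_of_injective _ (FaithfulSMul.algebraMap_injective R S)]
      exact bot_le)
    exact ⟨RelSeries.singleton _ ⟨Q, hQ⟩, rfl, PrimeSpectrum.ext h⟩
  | snoc l p hp ih =>
    obtain ⟨l', hlen, hlast⟩ := ih
    have hlt : l.last < p := hp
    have h' : l'.last.asIdeal.comap (algebraMap R S) = l.last.asIdeal :=
      congrArg PrimeSpectrum.asIdeal hlast
    obtain ⟨Q, hQl, hQ, h⟩ := Ideal.exists_ideal_over_prime_of_isIntegral (S := S) p.asIdeal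
      l'.last.asIdeal (h'.trans_le (PrimeSpectrum.asIdeal_le_asIdeal _ _ |>.2 hlt.le))
    have hQlt : l'.last < ⟨Q, hQ⟩ := by
      refine lt_of_le_of_ne hQl fun he => hlt.ne ?_
      rw [← hlast, he]
      exact PrimeSpectrum.ext h
    refine ⟨l'.snoc ⟨Q, hQ⟩ hQlt, by simp [hlen], ?_⟩
    rw [RelSeries.last_snoc, RelSeries.last_snoc]
    exact PrimeSpectrum.ext h

theorem ringKrullDim_eq_of_isIntegral (R : Type u) (S : Type v) [CommRing R] [CommRing S]
    [Algebra R S] [Algebra.IsIntegral R S] [FaithfulSMul R S] :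
    ringKrullDim R = ringKrullDim S := by
  refine le_antisymm ?_ ?_
  · refine iSup_le fun l => ?_
    obtain ⟨l', hlen, -⟩ := exists_ltSeries_of_isIntegral (S := S) l
    rw [← hlen]
    exact le_iSup_of_le l' le_rfl
  · refine Order.krullDim_le_of_strictMono (PrimeSpectrum.comap (algebraMap R S)) ?_
    intro p q hpq
    exact Ideal.IsIntegral.comap_lt_comap hpq

/-- In a valuation ring of dimension other than one that is not a field, the powers of a generator
of the maximal ideal have a nonzero common multiple. -/
theorem exists_forall_valuation_le_pow_of_ringKrullDim_ne_one {L : Type v} [Field L]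
    {V : ValuationSubring L} (hV : V ≠ ⊤) (h : ringKrullDim V ≠ 1) {π : L}
    (hmax : ∀ q, V.valuation q < 1 → V.valuation q ≤ V.valuation π) :
    ∃ z : L, z ∈ V ∧ z ≠ 0 ∧ ∀ n : ℕ, V.valuation z ≤ V.valuation π ^ n := by
  have hf : ¬ IsField V := by
    intro hf
    refine hV (eq_top_iff.2 fun x _ => ?_)
    rcases V.mem_or_inv_mem x with hx | hx
    · exact hx
    · by_cases hx0 : x = 0
      · exact hx0 ▸ V.zero_mem
      · obtain ⟨y, hy⟩ := hf.mul_inv_cancel (a := (⟨x⁻¹, hx⟩ : V))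
          (fun h => hx0 (by simpa using congrArg Subtype.val h))
        have hy' : x⁻¹ * y = 1 := congrArg Subtype.val hy
        have : (y : L) = x := by
          have := congrArg (x * ·) hy'
          simpa [mul_inv_cancel_left₀ hx0] using this
        exact this ▸ y.2
  rw [Ne, ringKrullDim_eq_one_iff_of_isLocalRing_isDomain] at h
  push Not at h
  obtain ⟨z, hz0, hz⟩ := h hf
  obtain ⟨q, hq, hqz⟩ := SetLike.not_le_iff_exists.1 hz
  refine ⟨z, z.2, by simpa using hz0, fun n => ?_⟩
  by_contra! hlt
  refine hqz ⟨n, Ideal.mem_span_singleton.2 ?_⟩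
  have h1 : V.valuation ((q ^ n : V) : L) ≤ V.valuation z := by
    refine le_trans ?_ hlt.le
    push_cast
    rw [map_pow]
    exact pow_le_pow_left₀ zero_le (hmax _ ((V.valuation_lt_one_iff q).1 hq)) n
  obtain ⟨a, ha⟩ := (V.valuation_le_iff _ _).1 h1
  exact ⟨a, Subtype.ext (by rw [← ha, mul_comm]; rfl)⟩

/-! ### Strong discreteness of an intersection of two valuation rings -/

/-- Strong discreteness of an intersection `D` of two valuation rings passes to each of them. Let
`P` be an idempotent prime of `V`, and let `p` be its contraction to `D`. If `p` contains a unit of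
`W`, then `p * p` and `p` agree both at `V` and at `W`; otherwise `P` is contained in `D`, and equals
`p`. So `p` is idempotent in both cases. -/
theorem ValuationSubring.isStronglyDiscrete_of_inter {L : Type v} [Field L]
    {V W : ValuationSubring L} {D : Type v} [CommRing D] (ι : D →+* L)
    (hι : Function.Injective ι) (hD : ∀ z, (V.valuation z ≤ 1 ∧ W.valuation z ≤ 1) ↔ ∃ d, ι d = z)
    (hden : ∀ z, ∃ a s : D, ι s ≠ 0 ∧ z = ι a / ι s ∧ (V.valuation z ≤ 1 → V.valuation (ι s) = 1) ∧
      (W.valuation z ≤ 1 → W.valuation (ι s) = 1))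
    (h : IsStronglyDiscrete D) : IsStronglyDiscrete V := by
  intro P hP hP0 hPP
  have hιV : ∀ d, ι d ∈ V := fun d => (V.valuation_le_one_iff _).1 ((hD _).2 ⟨d, rfl⟩).1
  let j : D →+* V := ι.codRestrict V.toSubring hιV
  have hj : ∀ d, (j d : L) = ι d := fun d => rfl
  let p := P.comap j
  have hp : p.IsPrime := Ideal.comap_isPrime j P
  have hmem : ∀ d, d ∈ p ↔ j d ∈ P := fun d => Iff.rfl
  have hdenV : ∀ z ∈ P, ∃ a ∈ p, ∃ s : D, V.valuation (ι s) = 1 ∧ ι s * z = ι a := by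
    intro z hz
    obtain ⟨a, s, hs0, e, hs, -⟩ := hden z
    have e' : ι s * z = ι a := by
      rw [e]; field_simp
    refine ⟨a, ?_, s, hs (V.valuation_le_one z), e'⟩
    have : j a = j s * z := Subtype.ext e'.symm
    rw [hmem, this]
    exact P.mul_mem_left _ hz
  have hp0 : p ≠ ⊥ := by
    obtain ⟨z, hz, hz0⟩ := Submodule.exists_mem_ne_zero_of_ne_bot hP0
    obtain ⟨a, ha, s, hs, e⟩ := hdenV z hz
    intro hbot
    rw [hbot, Ideal.mem_bot] at ha
    rw [ha, map_zero, mul_eq_zero] at e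
    rcases e with e | e
    · simp [e] at hs
    · exact hz0 (Subtype.ext e)
  refine h p hp hp0 (le_antisymm Ideal.mul_le_left fun z hz => ?_)
  by_cases hW : ∃ τ ∈ p, W.valuation (ι τ) = 1
  · -- `p * p` contains multiples of `z` by units of `V` and of `W`
    obtain ⟨τ, hτ, hτW⟩ := hW
    have hσ : ∀ y ∈ P, ∃ σ a : D, V.valuation (ι σ) = 1 ∧ a ∈ p * p ∧ ι σ * y = ι a := by
      intro y hy
      rw [← hPP] at hy
      refine Submodule.mul_induction_on hy ?_ ?_
      · intro b hb c hc
        obtain ⟨a, ha, s, hs, e⟩ := hdenV b hb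
        obtain ⟨a', ha', s', hs', e'⟩ := hdenV c hc
        refine ⟨s * s', a * a', by rw [map_mul, map_mul, hs, hs', mul_one],
          Ideal.mul_mem_mul ha ha', ?_⟩
        rw [map_mul, map_mul, ← e, ← e']
        change ι s * ι s' * ((b : L) * c) = _
        ring
      · rintro b c ⟨σ, a, hσ, ha, e⟩ ⟨σ', a', hσ', ha', e'⟩
        refine ⟨σ * σ', σ' * a + σ * a', by rw [map_mul, map_mul, hσ, hσ', mul_one],
          Ideal.add_mem _ (Ideal.mul_mem_left _ _ ha) (Ideal.mul_mem_left _ _ ha'), ?_⟩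
        rw [map_add, map_mul, map_mul, map_mul, ← e, ← e']
        change ι σ * ι σ' * ((b : L) + c) = _
        ring
    obtain ⟨σ, a, hσV, ha, e⟩ := hσ (j z) hz
    obtain ⟨α, β, hα, hβ, h1⟩ := exists_eq_mul_add_mul (V := V) (W := W) (z := 1) (a := ι σ)
      (b := ι τ) (by rw [map_one, hσV]) (by rw [map_one, hτW])
    rw [← V.valuation_le_one_iff, ← W.valuation_le_one_iff, hD] at hα hβ
    obtain ⟨α, rfl⟩ := hα
    obtain ⟨β, rfl⟩ := hβ
    have hz' : z = α * a + β * (τ * z) := by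
      apply hι
      rw [map_add, map_mul, map_mul, map_mul, ← e, hj]
      linear_combination ι z * h1
    rw [hz']
    exact Ideal.add_mem _ (Ideal.mul_mem_left _ _ ha)
      (Ideal.mul_mem_left _ _ (Ideal.mul_mem_mul hτ hz))
  · -- `P` is contained in `D`
    push Not at hW
    have hPD : ∀ y ∈ P, ∃ d ∈ p, ι d = y := by
      intro y hy
      have hyW : W.valuation y ≤ 1 := by
        by_contra! hlt
        obtain ⟨c, s, hs0, e, -, hsW⟩ := hden (y : L)⁻¹
        have hy0 : (y : L) ≠ 0 := by
          intro h0
          simp [h0] at hlt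
        have e' : ι s = ι c * y := by
          field_simp at e
          linear_combination e
        refine hW s ?_ (hsW ?_)
        · have : j s = j c * y := Subtype.ext e'
          rw [hmem, this]
          exact P.mul_mem_left _ hy
        · rw [map_inv₀]
          exact inv_le_one_of_one_le₀ hlt.le
      obtain ⟨d, hd⟩ := (hD y).1 ⟨V.valuation_le_one y, hyW⟩
      refine ⟨d, ?_, hd⟩
      have : j d = y := Subtype.ext hd
      rwa [hmem, this]
    have key : ∀ y ∈ P, ∃ d ∈ p * p, ι d = y := by
      intro y hy
      rw [← hPP] at hy
      refine Submodule.mul_induction_on hy ?_ ?_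
      · intro b hb c hc
        obtain ⟨d, hd, e⟩ := hPD b hb
        obtain ⟨d', hd', e'⟩ := hPD c hc
        exact ⟨d * d', Ideal.mul_mem_mul hd hd', by rw [map_mul, e, e']; rfl⟩
      · rintro b c ⟨d, hd, e⟩ ⟨d', hd', e'⟩
        exact ⟨d + d', Ideal.add_mem _ hd hd', by rw [map_add, e, e']; rfl⟩
    obtain ⟨d, hd, e⟩ := key (j z) hz
    have : d = z := hι e
    rwa [← this]

/-! ### Stability of `R` and `D` -/

namespace ValuationPair

variable {k : Type u} {L : Type v} [Field k] [Field L] [Algebra k L] (P : ValuationPair k L)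

/-- The inclusion `R → L` as a `k`-algebra homomorphism. -/
def valR : P.R →ₐ[k] L := P.D.val.comp P.R.val

theorem valR_injective : Function.Injective P.valR :=
  Subtype.val_injective.comp Subtype.val_injective

theorem valR_mem_D (r : P.R) : P.valR r ∈ P.D := r.1.2

theorem exists_valR_eq (μ : P.D) (hμ : μ ∈ P.M) : ∃ r, P.valR r = μ :=
  ⟨⟨μ, P.mem_R_of_mem_M hμ⟩, rfl⟩

theorem isFinitelyStableDomain_R : IsFinitelyStableDomain P.R :=
  P.isFinitelyStableDomain_of_algHom P.valR P.valR_injective P.valR_mem_D P.exists_valR_eq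

theorem isStableRing_R (h₁ : IsStronglyDiscrete P.V₁) (h₂ : IsStronglyDiscrete P.V₂) :
    IsStableRing P.R :=
  P.isStableRing_of_algHom P.valR P.valR_injective P.valR_mem_D P.exists_valR_eq h₁ h₂

theorem isStableRing_D (h₁ : IsStronglyDiscrete P.V₁) (h₂ : IsStronglyDiscrete P.V₂) :
    IsStableRing P.D :=
  P.isStableRing_of_algHom P.D.val Subtype.val_injective (fun d => d.2)
    (fun μ _ => ⟨μ, rfl⟩) h₁ h₂

theorem MR_ne_bot : P.MR ≠ ⊥ := by
  obtain ⟨m, hm, hm0, -⟩ := P.exists_generator_M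
  have hmM : m ∈ P.M := hm ▸ Ideal.mem_span_singleton_self m
  intro h
  have h1 : (⟨m, P.mem_R_of_mem_M hmM⟩ : P.R) ∈ P.MR := hmM
  rw [h, Ideal.mem_bot] at h1
  exact hm0 (congrArg Subtype.val h1)

theorem isStableIdeal_MR : IsStableIdeal P.MR := by
  refine P.isFinitelyStableDomain_R _ ?_ P.MR_ne_bot
  obtain ⟨a, b, h⟩ := P.exists_MR_eq_span_pair
  exact h ▸ Submodule.fg_span (Set.toFinite _)

/-- A prime `p` of `D` is tested on the ideal `m p` of `R`, where `m` generates `M`. -/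
theorem isStronglyDiscrete_D_of_isStableRing_R (h : IsStableRing P.R) :
    IsStronglyDiscrete P.D := by
  intro p hp hp0
  obtain ⟨m, hm, hm0, -⟩ := P.exists_generator_M
  have hmM : m ∈ P.M := hm ▸ Ideal.mem_span_singleton_self m
  let I : Ideal P.R := (Ideal.span {m} * p).comap (algebraMap P.R P.D)
  have hI : ∀ r : P.R, r ∈ I ↔ ∃ q ∈ p, m * q = r := fun r => Ideal.mem_span_singleton_mul
  have hpI : ∀ q ∈ p, ∃ r ∈ I, algebraMap P.R P.D r = m * q := fun q hq =>
    ⟨⟨m * q, P.mem_R_of_mem_M (P.M.mul_mem_right _ hmM)⟩, (hI _).2 ⟨q, hq, rfl⟩, rfl⟩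
  have hI0 : I ≠ ⊥ := by
    obtain ⟨q, hq, hq0⟩ := Submodule.exists_mem_ne_zero_of_ne_bot hp0
    obtain ⟨r, hr, e⟩ := hpI q hq
    intro hbot
    rw [hbot, Ideal.mem_bot] at hr
    rw [hr, map_zero] at e
    exact mul_ne_zero hm0 hq0 e.symm
  refine (h I hI0).mul_self_ne_of_map_eq (algebraMap P.R P.D) hm0 ?_ hpI hp0 hp.ne_top
  intro r hr
  obtain ⟨q, hq, e⟩ := (hI r).1 hr
  exact ⟨q, hq, e.symm⟩

theorem isStronglyDiscrete_V₁ (h : IsStronglyDiscrete P.D) : IsStronglyDiscrete P.V₁ := by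
  refine ValuationSubring.isStronglyDiscrete_of_inter (V := P.V₁) (W := P.V₂)
    (algebraMap P.D L) Subtype.val_injective ?_ ?_ h
  · intro z
    rw [← mem_D_iff]
    exact ⟨fun hz => ⟨⟨z, hz⟩, rfl⟩, fun ⟨d, hd⟩ => hd ▸ d.2⟩
  · intro z
    obtain ⟨a, s, hs, e, h₁, h₂⟩ := P.exists_common_denominator z
    rw [mem_N₁_iff, not_lt] at h₁
    rw [mem_N₂_iff, not_lt] at h₂
    exact ⟨a, s, hs, e, fun hz => le_antisymm (P.valuation₁_le s) (h₁ hz),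
      fun hz => le_antisymm (P.valuation₂_le s) (h₂ hz)⟩

theorem isStronglyDiscrete_V₂ (h : IsStronglyDiscrete P.D) : IsStronglyDiscrete P.V₂ := by
  refine ValuationSubring.isStronglyDiscrete_of_inter (V := P.V₂) (W := P.V₁)
    (algebraMap P.D L) Subtype.val_injective ?_ ?_ h
  · intro z
    rw [and_comm, ← mem_D_iff]
    exact ⟨fun hz => ⟨⟨z, hz⟩, rfl⟩, fun ⟨d, hd⟩ => hd ▸ d.2⟩
  · intro z
    obtain ⟨a, s, hs, e, h₁, h₂⟩ := P.exists_common_denominator z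
    rw [mem_N₁_iff, not_lt] at h₁
    rw [mem_N₂_iff, not_lt] at h₂
    exact ⟨a, s, hs, e, fun hz => le_antisymm (P.valuation₂_le s) (h₂ hz),
      fun hz => le_antisymm (P.valuation₁_le s) (h₁ hz)⟩

theorem isStableRing_D_iff : IsStableRing P.D ↔ IsStronglyDiscrete P.D :=
  ⟨fun h => h.isStronglyDiscrete,
    fun h => P.isStableRing_D (P.isStronglyDiscrete_V₁ h) (P.isStronglyDiscrete_V₂ h)⟩

theorem isStableRing_R_iff : IsStableRing P.R ↔ IsStableRing P.D := by
  rw [isStableRing_D_iff]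
  exact ⟨P.isStronglyDiscrete_D_of_isStableRing_R,
    fun h => P.isStableRing_R (P.isStronglyDiscrete_V₁ h) (P.isStronglyDiscrete_V₂ h)⟩

/-! ### Dimension, the Archimedean property, and going-down -/

theorem isLocalization_V₁ :
    @IsLocalization.AtPrime _ _ P.V₁ _ P.incl₁.toAlgebra P.N₁ _ := by
  let := P.incl₁.toAlgebra
  refine (isLocalization_iff _ _).2 ⟨?_, ?_, ?_⟩
  · rintro ⟨s, hs⟩
    by_contra h
    exact hs h
  · intro z
    obtain ⟨a, s, hs0, e, hs, -⟩ := P.exists_common_denominator z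
    refine ⟨⟨a, s, hs (P.V₁.valuation_le_one z)⟩, Subtype.ext ?_⟩
    change (z : L) * s = a
    rw [e, div_mul_cancel₀ _ hs0]
  · intro x y h
    have h' : (x : L) = y := congrArg (fun t : P.V₁ => (t : L)) h
    exact ⟨1, by rw [Subtype.ext h']⟩

theorem isLocalization_V₂ :
    @IsLocalization.AtPrime _ _ P.V₂ _ P.incl₂.toAlgebra P.N₂ _ := by
  let := P.incl₂.toAlgebra
  refine (isLocalization_iff _ _).2 ⟨?_, ?_, ?_⟩
  · rintro ⟨s, hs⟩
    by_contra h
    exact hs h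
  · intro z
    obtain ⟨a, s, hs0, e, -, hs⟩ := P.exists_common_denominator z
    refine ⟨⟨a, s, hs (P.V₂.valuation_le_one z)⟩, Subtype.ext ?_⟩
    change (z : L) * s = a
    rw [e, div_mul_cancel₀ _ hs0]
  · intro x y h
    have h' : (x : L) = y := congrArg (fun t : P.V₂ => (t : L)) h
    exact ⟨1, by rw [Subtype.ext h']⟩

theorem height_N₁ : (P.N₁.height : WithBot ℕ∞) = ringKrullDim P.V₁ := by
  let := P.incl₁.toAlgebra
  have := P.isLocalization_V₁
  exact (IsLocalization.AtPrime.ringKrullDim_eq_height P.N₁ P.V₁).symm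

theorem height_N₂ : (P.N₂.height : WithBot ℕ∞) = ringKrullDim P.V₂ := by
  let := P.incl₂.toAlgebra
  have := P.isLocalization_V₂
  exact (IsLocalization.AtPrime.ringKrullDim_eq_height P.N₂ P.V₂).symm

theorem ringKrullDim_D : ringKrullDim P.D = max (ringKrullDim P.V₁) (ringKrullDim P.V₂) := by
  refine le_antisymm ?_ (max_le ?_ ?_)
  · rw [ringKrullDim_le_iff_isMaximal_height_le]
    intro I hI
    rcases (P.isMaximal_iff I).1 hI with rfl | rfl
    · exact P.height_N₁.trans_le (le_max_left _ _)
    · exact P.height_N₂.trans_le (le_max_right _ _)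
  · rw [← height_N₁]
    exact Ideal.height_le_ringKrullDim_of_ne_top P.isPrime_N₁.ne_top
  · rw [← height_N₂]
    exact Ideal.height_le_ringKrullDim_of_ne_top P.isPrime_N₂.ne_top

instance faithfulSMul_R_D : FaithfulSMul P.R P.D :=
  (faithfulSMul_iff_algebraMap_injective P.R P.D).2 Subtype.val_injective

theorem ringKrullDim_R : ringKrullDim P.R = max (ringKrullDim P.V₁) (ringKrullDim P.V₂) := by
  rw [ringKrullDim_eq_of_isIntegral P.R P.D, ringKrullDim_D]

theorem V₁_ne_top : P.V₁ ≠ ⊤ := fun h => P.not_le₂₁ (h ▸ le_top)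

theorem V₂_ne_top : P.V₂ ≠ ⊤ := fun h => P.not_le₁₂ (h ▸ le_top)

theorem exists_forall_valuation₁_le {π : L}
    (hmax : ∀ q, P.V₁.valuation q < 1 → P.V₁.valuation q ≤ P.V₁.valuation π)
    (h : ringKrullDim P.V₁ ≠ 1) :
    ∃ a : P.D, a ≠ 0 ∧ ∀ n : ℕ, P.V₁.valuation a ≤ P.V₁.valuation π ^ n := by
  obtain ⟨z, hz, hz0, hle⟩ := exists_forall_valuation_le_pow_of_ringKrullDim_ne_one P.V₁_ne_top h hmax
  obtain ⟨a, s, hs0, rfl, -⟩ := P.exists_common_denominator z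
  refine ⟨a, fun h0 => hz0 (by simp [h0]), fun n => le_trans ?_ (hle n)⟩
  rw [map_div₀]
  exact (le_div_iff₀ (zero_lt_iff.2 (by simpa using hs0))).2
    (mul_le_of_le_one_right zero_le (P.valuation₁_le s))

theorem exists_forall_valuation₂_le {π : L}
    (hmax : ∀ q, P.V₂.valuation q < 1 → P.V₂.valuation q ≤ P.V₂.valuation π)
    (h : ringKrullDim P.V₂ ≠ 1) :
    ∃ a : P.D, a ≠ 0 ∧ ∀ n : ℕ, P.V₂.valuation a ≤ P.V₂.valuation π ^ n := by
  obtain ⟨z, hz, hz0, hle⟩ := exists_forall_valuation_le_pow_of_ringKrullDim_ne_one P.V₂_ne_top h hmax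
  obtain ⟨a, s, hs0, rfl, -⟩ := P.exists_common_denominator z
  refine ⟨a, fun h0 => hz0 (by simp [h0]), fun n => le_trans ?_ (hle n)⟩
  rw [map_div₀]
  exact (le_div_iff₀ (zero_lt_iff.2 (by simpa using hs0))).2
    (mul_le_of_le_one_right zero_le (P.valuation₂_le s))

instance isLocalHom_R_V₁ : IsLocalHom (P.incl₁.comp (algebraMap P.R P.D)) := by
  refine ⟨fun r hr => (P.isUnit_R_iff r).2 fun h => ?_⟩
  exact h.1 hr

instance isLocalHom_R_V₂ : IsLocalHom (P.incl₂.comp (algebraMap P.R P.D)) := by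
  refine ⟨fun r hr => (P.isUnit_R_iff r).2 fun h => ?_⟩
  exact h.2 hr

theorem incl₁_comp_injective : Function.Injective (P.incl₁.comp (algebraMap P.R P.D)) :=
  fun _ _ h => P.valR_injective (congrArg (fun t : P.V₁ => (t : L)) h)

theorem incl₂_comp_injective : Function.Injective (P.incl₂.comp (algebraMap P.R P.D)) :=
  fun _ _ h => P.valR_injective (congrArg (fun t : P.V₂ => (t : L)) h)

theorem isArchimedeanDomain_R_iff :
    IsArchimedeanDomain P.R ↔ ringKrullDim P.V₁ = 1 ∨ ringKrullDim P.V₂ = 1 := by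
  constructor
  · intro h
    by_contra! hcon
    obtain ⟨m, hm, hm0, hmax₁, hmax₂⟩ := P.exists_generator_M
    have hmM : m ∈ P.M := hm ▸ Ideal.mem_span_singleton_self m
    obtain ⟨a, ha0, ha⟩ := P.exists_forall_valuation₁_le hmax₁ hcon.1
    obtain ⟨b, hb0, hb⟩ := P.exists_forall_valuation₂_le hmax₂ hcon.2
    -- the nonzero element `a b` lies in every `mⁿ⁺¹ D ⊆ mⁿ R`
    have hdvd : ∀ n : ℕ, m ^ n ∣ a * b := by
      intro n
      refine P.dvd_of_valuation_le ?_ ?_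
      · change P.V₁.valuation ((a : L) * b) ≤ P.V₁.valuation ((m : L) ^ n)
        rw [map_mul, map_pow]
        exact (mul_le_of_le_one_right zero_le (P.valuation₁_le b)).trans (ha n)
      · change P.V₂.valuation ((a : L) * b) ≤ P.V₂.valuation ((m : L) ^ n)
        rw [map_mul, map_pow]
        exact (mul_le_of_le_one_left zero_le (P.valuation₂_le a)).trans (hb n)
    have habM : a * b ∈ P.M := by
      rw [hm, Ideal.mem_span_singleton]
      simpa using hdvd 1
    let μ : P.R := ⟨m, P.mem_R_of_mem_M hmM⟩
    have hμ : ¬ IsUnit μ := fun hu => (P.isUnit_R_iff μ).1 hu hmM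
    have hmem : (⟨a * b, P.mem_R_of_mem_M habM⟩ : P.R) ∈ ⨅ n : ℕ, Ideal.span {μ ^ n} := by
      rw [Ideal.mem_iInf]
      intro n
      obtain ⟨d, hd⟩ := hdvd (n + 1)
      refine Ideal.mem_span_singleton.2 ⟨⟨m * d, P.mem_R_of_mem_M (P.M.mul_mem_right _ hmM)⟩, ?_⟩
      refine Subtype.ext ?_
      change a * b = m ^ n * (m * d)
      rw [hd]; ring
    rw [h μ hμ, Ideal.mem_bot] at hmem
    exact mul_ne_zero ha0 hb0 (congrArg Subtype.val hmem)
  · rintro (h | h)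
    · exact isArchimedeanDomain_of_ringKrullDim_eq_one _ P.incl₁_comp_injective h
    · exact isArchimedeanDomain_of_ringKrullDim_eq_one _ P.incl₂_comp_injective h

/-- A generator of `N₂` is a unit of `V₁`, so divisibility by its powers is decided in `V₂`. -/
theorem not_isArchimedeanDomain_D (h : ringKrullDim P.V₂ ≠ 1) : ¬ IsArchimedeanDomain P.D := by
  intro hD
  obtain ⟨y, hy, hy₁, -, hmax⟩ := P.exists_generator_N₂
  obtain ⟨a, ha0, ha⟩ := P.exists_forall_valuation₂_le hmax h
  have hyu : ¬ IsUnit y := fun hu =>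
    ((P.isUnit_iff y).1 hu).2 (hy ▸ Ideal.mem_span_singleton_self y)
  have hmem : a ∈ ⨅ n : ℕ, Ideal.span {y ^ n} := by
    rw [Ideal.mem_iInf]
    intro n
    refine Ideal.mem_span_singleton.2 (P.dvd_of_valuation_le ?_ ?_)
    · change _ ≤ P.V₁.valuation ((y : L) ^ n)
      rw [map_pow, hy₁, one_pow]
      exact P.valuation₁_le a
    · change _ ≤ P.V₂.valuation ((y : L) ^ n)
      rw [map_pow]
      exact ha n
  rw [hD y hyu, Ideal.mem_bot] at hmem
  exact ha0 hmem

theorem eq_N₁_of_le_N₁ (h : ringKrullDim P.V₁ = 1) {p : Ideal P.D} (hp : p.IsPrime)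
    (hp0 : p ≠ ⊥) (hle : p ≤ P.N₁) : p = P.N₁ := by
  refine le_antisymm hle fun d hd => ?_
  obtain ⟨z, hz, hz0⟩ := Submodule.exists_mem_ne_zero_of_ne_bot hp0
  have hz0' : P.incl₁ z ≠ 0 := fun h0 => hz0 (Subtype.ext (congrArg (fun t : P.V₁ => (t : L)) h0))
  obtain ⟨n, hn⟩ := (ringKrullDim_eq_one_iff_of_isLocalRing_isDomain.1 h).2 _ hz0' hd
  obtain ⟨c, hc⟩ := Ideal.mem_span_singleton.1 hn
  obtain ⟨a, s, hs, e⟩ := (P.mem_V₁_iff c).1 c.2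
  have hs0 : (s : L) ≠ 0 := by
    intro h0
    refine hs ?_
    rw [mem_N₁_iff, h0, map_zero]
    exact zero_lt_one
  have hmem : s * d ^ n ∈ p := by
    have hc' : (d : L) ^ n = z * c := congrArg Subtype.val hc
    have : s * d ^ n = z * a := by
      refine Subtype.ext ?_
      change (s : L) * (d : L) ^ n = z * a
      rw [hc', e]
      field_simp
    rw [this]
    exact p.mul_mem_right _ hz
  exact hp.mem_of_pow_mem n ((hp.mem_or_mem hmem).resolve_left fun h' => hs (hle h'))

/-- A nonzero nonmaximal prime of `R` is strictly below the contraction of `N₁`, but there is no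
nonzero prime of `D` strictly below `N₁`. -/
theorem not_hasGoingDown (h₁ : ringKrullDim P.V₁ = 1) (h₂ : 1 < ringKrullDim P.V₂) :
    ¬ Algebra.HasGoingDown P.R P.D := by
  intro hgd
  have hdim : ¬ Ring.KrullDimLE 1 P.R := by
    rw [Ring.krullDimLE_iff, not_le, ringKrullDim_R]
    exact lt_max_of_lt_right h₂
  rw [Ring.krullDimLE_one_iff_of_noZeroDivisors] at hdim
  push Not at hdim
  obtain ⟨p, hp0, hp, hpmax⟩ := hdim
  have hunder : P.N₁.under P.R = P.MR := by
    ext r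
    refine ⟨fun hr => ?_, fun hr => hr.1⟩
    by_contra hr'
    have hu := ((P.isUnit_R_iff r).2 hr').map (algebraMap P.R P.D)
    exact ((P.isUnit_iff _).1 hu).1 hr
  have hlt : p < P.N₁.under P.R := by
    rw [hunder]
    refine lt_of_le_of_ne ?_ fun he => hpmax ((P.MR_isMaximal_iff p).2 he)
    intro r hr
    by_contra hr'
    exact hp.ne_top (Ideal.eq_top_of_isUnit_mem _ hr ((P.isUnit_R_iff r).2 hr'))
  obtain ⟨q, hq, hqp, hover⟩ := hgd.exists_ideal_le_liesOver_of_lt P.N₁ hlt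
  have hq0 : q ≠ ⊥ := by
    rintro rfl
    refine hp0 ?_
    rw [hover.over, Ideal.under_def,
      Ideal.comap_bot_of_injective _ (FaithfulSMul.algebraMap_injective P.R P.D)]
  have hqN := P.eq_N₁_of_le_N₁ h₁ hqp hq0 hq
  rw [hover.over, hqN] at hlt
  exact lt_irrefl _ hlt

/-- `D` is the integral closure of `R` in `L`. -/
noncomputable def integralClosureEquiv : P.D ≃ₐ[P.R] integralClosure P.R L :=
  AlgEquiv.ofBijective
    { toFun := fun d => ⟨d, (P.isIntegral_iff d).2 d.2⟩
      map_one' := rfl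
      map_mul' := fun _ _ => rfl
      map_zero' := rfl
      map_add' := fun _ _ => rfl
      commutes' := fun _ => rfl }
    ⟨fun _ _ h => Subtype.ext (congrArg (fun t => ((t : integralClosure P.R L) : L)) h),
      fun z => ⟨⟨z, (P.isIntegral_iff z).1 z.2⟩, rfl⟩⟩

/-- The case of a discrete valuation ring and a strongly discrete valuation ring of higher
dimension. -/
theorem archimedean_and_stable_of_isStronglyDiscrete {n : ℕ∞} (hn : 2 ≤ n) (hV₁ : IsStronglyDiscrete P.V₁)
    (hV₂ : IsStronglyDiscrete P.V₂) (h₁ : ringKrullDim P.V₁ = 1) (h₂ : ringKrullDim P.V₂ = n) :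
    ringKrullDim P.R = n ∧ IsArchimedeanDomain P.R ∧ IsStableRing P.R ∧
      SatisfiesACCP P.R ∧ ¬ IsArchimedeanDomain (integralClosure P.R L) ∧
      ¬ Algebra.HasGoingDown P.R P.D := by
  have hlt : 1 < ringKrullDim P.V₂ := by
    rw [h₂]
    exact_mod_cast lt_of_lt_of_le (by norm_num) hn
  have := isDiscreteValuationRing_of_ringKrullDim_eq_one P.principal₁ h₁
  refine ⟨?_, P.isArchimedeanDomain_R_iff.2 (Or.inl h₁), P.isStableRing_R hV₁ hV₂,
    satisfiesACCP_of_isLocalHom _ P.incl₁_comp_injective, fun h => ?_, P.not_hasGoingDown h₁ hlt⟩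
  · rw [ringKrullDim_R, h₁, ← h₂]
    exact max_eq_right hlt.le
  · exact P.not_isArchimedeanDomain_D hlt.ne'
      (h.of_ringEquiv P.integralClosureEquiv.symm.toRingEquiv)

end ValuationPair

/-! ### Algebraically independent power series -/

theorem Subfield.countable_bot (k : Type u) [Field k] : Countable (⊥ : Subfield k) := by
  have h := Subfield.cardinalMk_closure_le_max (∅ : Set k)
  rw [Subfield.closure_empty] at h
  rw [← Cardinal.mk_le_aleph0_iff]
  simpa using h

theorem PowerSeries.not_countable (k : Type u) [Field k] : ¬ Countable (PowerSeries k) := by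
  classical
  intro h
  let f : Set ℕ → PowerSeries k := fun s => PowerSeries.mk fun n => if n ∈ s then 1 else 0
  have hf : Function.Injective f := by
    intro s t hst
    ext n
    have := congrArg (PowerSeries.coeff n) hst
    simp only [f, PowerSeries.coeff_mk] at this
    by_cases hs : n ∈ s <;> by_cases ht : n ∈ t <;> simp_all
  have : Countable (Set ℕ) := hf.countable
  obtain ⟨g, hg⟩ := exists_surjective_nat (Set ℕ)
  exact Function.cantor_surjective g hg

/-- By cardinality, the power series over a countable field have uncountable transcendence
degree. -/
theorem PowerSeries.exists_algebraicIndependent_of_countable (k : Type u) [Field k]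
    [Countable k] : ∃ f : ℕ → PowerSeries k, AlgebraicIndependent k f := by
  obtain ⟨s, hs⟩ := exists_isTranscendenceBasis k (PowerSeries k)
  have hinf : Infinite s := by
    by_contra hfin
    rw [not_infinite_iff_finite] at hfin
    have halg := hs.isAlgebraic
    have hc : Countable (Algebra.adjoin k (Set.range ((↑) : s → PowerSeries k))) := by
      have e := hs.1.aevalEquiv
      have : Countable (MvPolynomial s k) := by
        rw [← Cardinal.mk_le_aleph0_iff]
        exact MvPolynomial.cardinalMk_le_max.trans (by simp)
      exact e.symm.injective.countable
    have := Algebra.IsAlgebraic.cardinalMk_le_max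
      (Algebra.adjoin k (Set.range ((↑) : s → PowerSeries k))) (PowerSeries k)
    refine PowerSeries.not_countable k (Cardinal.mk_le_aleph0_iff.1 (this.trans ?_))
    exact max_le (Cardinal.mk_le_aleph0_iff.2 hc) le_rfl
  exact ⟨_, hs.1.comp _ (Infinite.natEmbedding s).injective⟩

theorem PowerSeries.coeff_aeval_monomial {A : Type v} [Field A] {ι : Type w}
    (g : ι → PowerSeries A) (s : ι →₀ ℕ) (c : A) (n : ℕ) :
    PowerSeries.coeff n (MvPolynomial.aeval g (MvPolynomial.monomial s c)) =
      c * PowerSeries.coeff n (s.prod fun i e => g i ^ e) := by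
  simp [MvPolynomial.aeval_monomial]

/-- Algebraically independent power series remain algebraically independent after an extension
of the field of coefficients, since linear independence over the smaller field is preserved. -/
theorem PowerSeries.algebraicIndependent_map {F : Type v} {k : Type u} [Field F] [Field k]
    [Algebra F k] {ι : Type w} {f : ι → PowerSeries F} (hf : AlgebraicIndependent F f) :
    AlgebraicIndependent k (fun i => PowerSeries.map (algebraMap F k) (f i)) := by
  rw [algebraicIndependent_iff]
  intro p hp
  have hmon : ∀ s : ι →₀ ℕ, s.prod (fun i e => PowerSeries.map (algebraMap F k) (f i) ^ e) =
      PowerSeries.map (algebraMap F k) (s.prod fun i e => f i ^ e) := by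
    intro s
    simp [Finsupp.prod, map_prod]
  -- apply `F`-linear functionals of `k` to the coefficients of the relation
  have key : ∀ l : k →ₗ[F] F, ∀ s ∈ p.support, l (p.coeff s) = 0 := by
    intro l
    have hq : ∑ s ∈ p.support, MvPolynomial.monomial s (l (p.coeff s)) = 0 := by
      refine (algebraicIndependent_iff.1 hf) _ ?_
      ext n
      have h1 := congrArg (fun g => l (PowerSeries.coeff n g)) hp
      rw [← MvPolynomial.support_sum_monomial_coeff p] at h1
      simp only [map_sum, PowerSeries.coeff_aeval_monomial, hmon, PowerSeries.coeff_map,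
        map_zero] at h1 ⊢
      rw [← h1]
      refine Finset.sum_congr rfl fun s _ => ?_
      rw [mul_comm (p.coeff s), ← Algebra.smul_def, map_smul, smul_eq_mul, mul_comm]
    intro s hs
    have h2 := congrArg (MvPolynomial.coeff s) hq
    classical
    simp only [MvPolynomial.coeff_sum, MvPolynomial.coeff_monomial, MvPolynomial.coeff_zero] at h2
    rwa [Finset.sum_ite_eq' p.support s, if_pos hs] at h2
  ext s
  rw [MvPolynomial.coeff_zero]
  by_contra hne
  exact hne ((Module.forall_dual_apply_eq_zero_iff F (p.coeff s)).1 fun l =>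
    key l s (MvPolynomial.mem_support_iff.2 hne))

/-- Over every field there are countably many algebraically independent power series. They are
found over the prime field, which is countable. -/
theorem PowerSeries.exists_algebraicIndependent (k : Type u) [Field k] :
    ∃ f : ℕ → PowerSeries k, AlgebraicIndependent k f := by
  have := Subfield.countable_bot k
  obtain ⟨f, hf⟩ := PowerSeries.exists_algebraicIndependent_of_countable (⊥ : Subfield k)
  exact ⟨_, PowerSeries.algebraicIndependent_map (k := k) hf⟩

/-! ### Valuation rings of additive valuations -/

section AddValuationRing

variable {k : Type u} {L : Type v} {Γ : Type w} [Field k] [Field L] [Algebra k L]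
  [AddCommGroup Γ] [LinearOrder Γ] [IsOrderedAddMonoid Γ]

theorem AddValuation.exists_eq_coe (ν : AddValuation L (WithTop Γ)) {z : L} (hz : z ≠ 0) :
    ∃ γ : Γ, ν z = γ ∧ ν z⁻¹ = (-γ : Γ) := by
  obtain ⟨a, ha⟩ := WithTop.ne_top_iff_exists.1 ((AddValuation.ne_top_iff ν).2 hz)
  obtain ⟨b, hb⟩ := WithTop.ne_top_iff_exists.1 ((AddValuation.ne_top_iff ν).2 (inv_ne_zero hz))
  have h := AddValuation.map_mul ν z z⁻¹
  rw [mul_inv_cancel₀ hz, AddValuation.map_one, ← ha, ← hb] at h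
  have h' : a + b = 0 := by exact_mod_cast h.symm
  refine ⟨a, ha.symm, ?_⟩
  rw [← hb, neg_eq_of_add_eq_zero_right h']

/-- The ring of elements of nonnegative additive valuation. -/
def ValuationSubring.ofAddValuation (ν : AddValuation L (WithTop Γ)) : ValuationSubring L where
  carrier := {z | 0 ≤ ν z}
  zero_mem' := by simp
  one_mem' := by simp
  add_mem' := fun hx hy => (le_min hx hy).trans (AddValuation.map_add ν _ _)
  mul_mem' := by
    intro x y hx hy
    change 0 ≤ ν (x * y)
    rw [AddValuation.map_mul]
    exact add_nonneg hx hy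
  neg_mem' := by
    intro x hx
    change 0 ≤ ν (-x)
    rwa [AddValuation.map_neg]
  mem_or_inv_mem' := by
    intro z
    change 0 ≤ ν z ∨ 0 ≤ ν z⁻¹
    by_cases hz : z = 0
    · simp [hz]
    · obtain ⟨γ, h, h'⟩ := ν.exists_eq_coe hz
      rw [h, h']
      rcases le_total 0 γ with h0 | h0
      · exact Or.inl (by exact_mod_cast h0)
      · exact Or.inr (by exact_mod_cast neg_nonneg.2 h0)

namespace ValuationSubring

variable {ν : AddValuation L (WithTop Γ)}

theorem mem_ofAddValuation {z : L} : z ∈ ofAddValuation ν ↔ 0 ≤ ν z := Iff.rfl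

theorem ofAddValuation_dvd_iff {a b : ofAddValuation ν} : a ∣ b ↔ ν a ≤ ν b := by
  constructor
  · rintro ⟨c, rfl⟩
    change ν a ≤ ν (a * c)
    rw [AddValuation.map_mul]
    exact le_add_of_nonneg_right c.2
  · intro h
    by_cases ha : (a : L) = 0
    · have hb : (b : L) = 0 := by
        rw [ha, AddValuation.map_zero, top_le_iff, AddValuation.top_iff] at h
        exact h
      exact ⟨0, Subtype.ext (by simpa using hb)⟩
    · obtain ⟨γ, hγ, hγ'⟩ := ν.exists_eq_coe ha
      refine ⟨⟨(a : L)⁻¹ * b, ?_⟩, Subtype.ext ?_⟩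
      · rw [mem_ofAddValuation, AddValuation.map_mul, hγ']
        rw [hγ] at h
        have h2 := add_le_add_right h ((-γ : Γ) : WithTop Γ)
        rwa [← WithTop.coe_add, neg_add_cancel, WithTop.coe_zero] at h2
      · change (b : L) = a * ((a : L)⁻¹ * b)
        rw [mul_inv_cancel_left₀ ha]

theorem mem_maximalIdeal_ofAddValuation {z : ofAddValuation ν} :
    z ∈ IsLocalRing.maximalIdeal (ofAddValuation ν) ↔ 0 < ν z := by
  rw [IsLocalRing.mem_maximalIdeal, _root_.mem_nonunits_iff, isUnit_iff_dvd_one,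
    ofAddValuation_dvd_iff]
  simp

theorem isPrincipal_ofAddValuation {π : L} (hπ : 0 < ν π) (h : ∀ z, 0 < ν z → ν π ≤ ν z) :
    (IsLocalRing.maximalIdeal (ofAddValuation ν)).IsPrincipal := by
  refine ⟨⟨π, hπ.le⟩, le_antisymm ?_ ?_⟩
  · intro z hz
    exact Ideal.mem_span_singleton.2
      (ofAddValuation_dvd_iff.2 (h z (mem_maximalIdeal_ofAddValuation.1 hz)))
  · rw [Ideal.submodule_span_eq, Ideal.span_singleton_le_iff_mem, mem_maximalIdeal_ofAddValuation]
    exact hπ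

theorem exists_decomp_ofAddValuation
    (h : ∀ z, 0 ≤ ν z → ∃ c : k, 0 < ν (z - algebraMap k L c)) (x : ofAddValuation ν) :
    ∃ c : k, ∃ q ∈ IsLocalRing.maximalIdeal (ofAddValuation ν),
      (x : L) = algebraMap k L c + (q : L) := by
  obtain ⟨c, hc⟩ := h x x.2
  exact ⟨c, ⟨_, hc.le⟩, mem_maximalIdeal_ofAddValuation.2 hc, by simp⟩

theorem isPrime_radical_span_singleton {V : Type*} [CommRing V] [IsDomain V] [ValuationRing V]
    {x : V} (hx : ¬ IsUnit x) : (Ideal.span {x}).radical.IsPrime := by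
  refine ⟨?_, ?_⟩
  · rw [Ne, Ideal.radical_eq_top, Ideal.span_singleton_eq_top]
    exact hx
  · have key : ∀ {a b : V}, a ∣ b → a * b ∈ (Ideal.span {x}).radical →
        b ∈ (Ideal.span {x}).radical := by
      rintro a b h ⟨n, hn⟩
      refine ⟨n + n, ?_⟩
      rw [pow_add]
      rw [mul_pow] at hn
      rw [Ideal.mem_span_singleton] at hn ⊢
      exact hn.trans (mul_dvd_mul_right (pow_dvd_pow_of_dvd h n) _)
    intro a b hab
    rcases ValuationRing.dvd_total a b with h | h
    · exact Or.inr (key h hab)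
    · exact Or.inl (key h (by rwa [mul_comm]))

theorem ringKrullDim_ofAddValuation_int {ν : AddValuation L (WithTop ℤ)} {z : L} (hz0 : z ≠ 0)
    (hz : 0 < ν z) : ringKrullDim (ofAddValuation ν) = 1 := by
  rw [ringKrullDim_eq_one_iff_of_isLocalRing_isDomain]
  refine ⟨fun hf => ?_, fun x hx q hq => ?_⟩
  · have h1 : (⟨z, hz.le⟩ : ofAddValuation ν) ∈ IsLocalRing.maximalIdeal (ofAddValuation ν) :=
      mem_maximalIdeal_ofAddValuation.2 hz
    rw [IsLocalRing.isField_iff_maximalIdeal_eq.1 hf, Ideal.mem_bot] at h1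
    exact hz0 (congrArg Subtype.val h1)
  · have hx0 : (x : L) ≠ 0 := by simpa using hx
    obtain ⟨a, ha, -⟩ := ν.exists_eq_coe hx0
    rw [mem_maximalIdeal_ofAddValuation] at hq
    refine ⟨a.toNat, Ideal.mem_span_singleton.2 (ofAddValuation_dvd_iff.2 ?_)⟩
    change ν x ≤ ν ((q : L) ^ a.toNat)
    rw [AddValuation.map_pow, ha]
    by_cases hq0 : (q : L) = 0
    · by_cases ha0 : a.toNat = 0
      · rw [ha0, zero_smul]
        exact_mod_cast Int.toNat_eq_zero.1 ha0
      · obtain ⟨n, hn⟩ := Nat.exists_eq_succ_of_ne_zero ha0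
        rw [hq0, AddValuation.map_zero, hn, succ_nsmul, add_top]
        exact _root_.le_top
    · obtain ⟨b, hb, -⟩ := ν.exists_eq_coe hq0
      rw [hb] at hq ⊢
      have hb1 : 0 < b := by exact_mod_cast hq
      rw [← WithTop.coe_nsmul, WithTop.coe_le_coe, nsmul_eq_mul]
      have h1 : a ≤ a.toNat := Int.self_le_toNat a
      nlinarith [Int.natCast_nonneg a.toNat]

theorem exists_min_ofAddValuation_int {ν : AddValuation L (WithTop ℤ)} {z : L} (hz0 : z ≠ 0)
    (hz : 0 < ν z) : ∃ π : L, 0 < ν π ∧ ∀ x, 0 < ν x → ν π ≤ ν x := by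
  classical
  have hex : ∃ n : ℕ, ∃ x : L, 0 < ν x ∧ ν x = ((n : ℤ) : WithTop ℤ) := by
    obtain ⟨a, ha, -⟩ := ν.exists_eq_coe hz0
    have ha0 : 0 < a := by rw [ha] at hz; exact_mod_cast hz
    exact ⟨a.toNat, z, hz, by rw [ha, Int.toNat_of_nonneg ha0.le]⟩
  obtain ⟨π, hπ, e⟩ := Nat.find_spec hex
  refine ⟨π, hπ, fun x hx => ?_⟩
  by_cases hx0 : x = 0
  · simp [hx0]
  · obtain ⟨b, hb, -⟩ := ν.exists_eq_coe hx0
    have hb0 : 0 < b := by rw [hb] at hx; exact_mod_cast hx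
    have h := Nat.find_min' hex ⟨x, hx, by rw [hb, Int.toNat_of_nonneg hb0.le]⟩
    rw [e, hb, WithTop.coe_le_coe]
    omega

end ValuationSubring

end AddValuationRing

/-! ### Valuations from embeddings in Hahn series -/

section HahnSeries

variable {k : Type u} {L : Type v} {Γ : Type w} [Field k] [Field L]
  [AddCommGroup Γ] [LinearOrder Γ] [IsOrderedAddMonoid Γ]

/-- The order of an element of a field embedded into a field of Hahn series. -/
noncomputable def hahnAddVal (φ : L →+* HahnSeries Γ k) : AddValuation L (WithTop Γ) :=
  (HahnSeries.addVal Γ k).comap φ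

theorem hahnAddVal_apply (φ : L →+* HahnSeries Γ k) (z : L) :
    hahnAddVal φ z = (φ z).orderTop := HahnSeries.addVal_apply

variable [Algebra k L] {φ : L →+* HahnSeries Γ k}
  (hφ : ∀ c, φ (algebraMap k L c) = HahnSeries.C c)

include hφ

theorem hahnAddVal_algebraMap_nonneg (c : k) : 0 ≤ hahnAddVal φ (algebraMap k L c) := by
  rw [hahnAddVal_apply, hφ]
  exact HahnSeries.orderTop_single_le

/-- The constant coefficient is the residue. -/
theorem exists_residue_hahnAddVal {z : L} (hz : 0 ≤ hahnAddVal φ z) :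
    ∃ c : k, 0 < hahnAddVal φ (z - algebraMap k L c) := by
  refine ⟨(φ z).coeff 0, ?_⟩
  rw [hahnAddVal_apply] at hz ⊢
  rw [map_sub, hφ, HahnSeries.C_apply]
  refine lt_of_le_of_ne ?_ ?_
  · exact (le_min hz HahnSeries.orderTop_single_le).trans HahnSeries.min_orderTop_le_orderTop_sub
  · exact (HahnSeries.orderTop_ne_of_coeff_eq_zero (by simp)).symm

/-- A nonconstant element, its inverse, or its difference from its residue has positive value. -/
theorem exists_hahnAddVal_pos {x : L} (hx : x ∉ Set.range (algebraMap k L)) :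
    ∃ z : L, z ≠ 0 ∧ 0 < hahnAddVal φ z := by
  have hx0 : x ≠ 0 := by
    rintro rfl
    exact hx ⟨0, map_zero _⟩
  obtain ⟨γ, h, h'⟩ := (hahnAddVal φ).exists_eq_coe hx0
  rcases lt_trichotomy 0 γ with h0 | h0 | h0
  · exact ⟨x, hx0, by rw [h]; exact_mod_cast h0⟩
  · obtain ⟨c, hc⟩ := exists_residue_hahnAddVal hφ (z := x) (by rw [h, ← h0]; exact le_rfl)
    refine ⟨_, fun hxc => hx ⟨c, ?_⟩, hc⟩
    exact (sub_eq_zero.1 hxc).symm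
  · exact ⟨x⁻¹, inv_ne_zero hx0, by rw [h']; exact_mod_cast neg_pos.2 h0⟩

end HahnSeries

/-! ### The monomial valuation -/

section Colex

variable {k : Type u} [Field k] {ι : Type w}

/-- The `i`-th basis vector of the group `ℤ^(ι)`. In the colexicographic order, `e_i` is
infinitely large compared to `e_j` for `j < i`. -/
noncomputable def colexBasis (i : ι) : Colex (ι →₀ ℤ) := toColex (Finsupp.single i 1)

theorem ofColex_colexBasis_of_ne {i j : ι} (h : i ≠ j) : ofColex (colexBasis i) j = 0 := by
  simp [colexBasis, h]

theorem ofColex_colexBasis_self (i : ι) : ofColex (colexBasis i) i = 1 := by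
  simp [colexBasis]

theorem ofColex_nsmul_apply (n : ℕ) (γ : Colex (ι →₀ ℤ)) (i : ι) :
    ofColex (n • γ) i = n * ofColex γ i := by
  change (n • ofColex γ : ι →₀ ℤ) i = _
  rw [Finsupp.smul_apply, nsmul_eq_mul]

/-- The exponent of a monomial, as an element of the group `ℤ^(ι)`. -/
noncomputable def colexExponent (s : ι →₀ ℕ) : Colex (ι →₀ ℤ) :=
  toColex (s.mapRange (fun n : ℕ => (n : ℤ)) rfl)

theorem colexExponent_injective : Function.Injective (colexExponent (ι := ι)) := by
  intro s t h
  ext i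
  have := congrArg (fun γ : Colex (ι →₀ ℤ) => ofColex γ i) h
  simpa [colexExponent] using this

theorem colexExponent_add (s t : ι →₀ ℕ) :
    colexExponent (s + t) = colexExponent s + colexExponent t := by
  exact congrArg toColex (Finsupp.mapRange_add (fun _ _ => Nat.cast_add _ _) s t)

theorem colexExponent_single (i : ι) (n : ℕ) :
    colexExponent (Finsupp.single i n) = n • colexBasis i := by
  change toColex _ = toColex (n • Finsupp.single i (1 : ℤ))
  congr 1
  ext j
  simp

variable [LinearOrder ι]

theorem exists_colex_leading {γ : Colex (ι →₀ ℤ)} (h : 0 < γ) :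
    ∃ j, (∀ l, j < l → ofColex γ l = 0) ∧ 0 < ofColex γ j := by
  obtain ⟨j, hj, hj'⟩ := Finsupp.Colex.lt_iff.1 h
  exact ⟨j, fun l hl => (hj l hl).symm, hj'⟩

/-- The order on `ℤ^(ι)` is decided by the coordinate of largest index that does not vanish. -/
theorem colex_lt_of_leading {γ δ : Colex (ι →₀ ℤ)} {j : ι}
    (hγ : ∀ l, j < l → ofColex γ l = 0) (hδ : ∀ l, j < l → ofColex δ l = 0)
    (h : ofColex γ j < ofColex δ j) : γ < δ :=
  Finsupp.Colex.lt_iff.2 ⟨j, fun l hl => (hγ l hl).trans (hδ l hl).symm, h⟩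

theorem colexBasis_pos (i : ι) : 0 < colexBasis i :=
  colex_lt_of_leading (j := i) (fun _ _ => rfl) (fun _ hl => ofColex_colexBasis_of_ne hl.ne)
    (by rw [ofColex_colexBasis_self]; exact zero_lt_one)

theorem nsmul_colexBasis_lt {i j : ι} (h : i < j) (n : ℕ) : n • colexBasis i < colexBasis j := by
  refine colex_lt_of_leading (j := j) (fun l hl => ?_) (fun l hl => ofColex_colexBasis_of_ne hl.ne)
    ?_
  · rw [ofColex_nsmul_apply, ofColex_colexBasis_of_ne (h.trans hl).ne, mul_zero]
  · rw [ofColex_nsmul_apply, ofColex_colexBasis_of_ne h.ne, mul_zero,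
      ofColex_colexBasis_self]
    exact zero_lt_one

/-- Each positive element is in the Archimedean class of a basis vector, that of its leading
index. -/
theorem exists_colexBasis_archimedean {γ : Colex (ι →₀ ℤ)} (h : 0 < γ) :
    ∃ i, ∃ n : ℕ, colexBasis i ≤ n • γ ∧ γ ≤ n • colexBasis i := by
  obtain ⟨j, hj, hj'⟩ := exists_colex_leading h
  refine ⟨j, (ofColex γ j).toNat + 2, (colex_lt_of_leading (j := j) ?_ ?_ ?_).le,
    (colex_lt_of_leading (j := j) ?_ ?_ ?_).le⟩
  · exact fun l hl => ofColex_colexBasis_of_ne hl.ne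
  · intro l hl
    rw [ofColex_nsmul_apply, hj l hl, mul_zero]
  · rw [ofColex_nsmul_apply, ofColex_colexBasis_self]
    push_cast
    nlinarith [Int.natCast_nonneg (ofColex γ j).toNat]
  · exact hj
  · intro l hl
    rw [ofColex_nsmul_apply, ofColex_colexBasis_of_ne hl.ne, mul_zero]
  · rw [ofColex_nsmul_apply, ofColex_colexBasis_self, mul_one]
    push_cast
    have := Int.self_le_toNat (ofColex γ j)
    omega

/-- The leading index of `γ` is at least `i` if a multiple of `γ` exceeds `colexBasis i`. -/
theorem exists_leading_of_colexBasis_le {γ : Colex (ι →₀ ℤ)} {i : ι} {n : ℕ}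
    (h : colexBasis i ≤ n • γ) :
    ∃ j, i ≤ j ∧ (∀ l, j < l → ofColex γ l = 0) ∧ 0 < ofColex γ j := by
  have hγ : 0 < γ := by
    by_contra! hle
    exact absurd (h.trans (nsmul_nonpos hle n)) (not_le_of_gt (colexBasis_pos i))
  obtain ⟨j, hj, hj'⟩ := exists_colex_leading hγ
  refine ⟨j, ?_, hj, hj'⟩
  by_contra! hlt
  refine absurd h (not_le_of_gt (colex_lt_of_leading (j := i) (fun l hl => ?_)
    (fun l hl => ofColex_colexBasis_of_ne hl.ne) ?_))
  · rw [ofColex_nsmul_apply, hj l (hlt.trans hl), mul_zero]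
  · rw [ofColex_nsmul_apply, hj i hlt, mul_zero, ofColex_colexBasis_self]
    exact zero_lt_one

/-- The sum of two elements whose Archimedean classes are at least that of `e_i` exceeds `e_i`. -/
theorem colexBasis_lt_add {γ δ : Colex (ι →₀ ℤ)} {i : ι} {n m : ℕ}
    (hγ : colexBasis i ≤ n • γ) (hδ : colexBasis i ≤ m • δ) : colexBasis i < γ + δ := by
  obtain ⟨a, hia, ha, ha'⟩ := exists_leading_of_colexBasis_le hγ
  obtain ⟨b, hib, hb, hb'⟩ := exists_leading_of_colexBasis_le hδ
  have hbasis : ∀ j, i ≤ j → ofColex (colexBasis i) j ≤ 1 := by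
    intro j _
    rcases eq_or_ne i j with rfl | hne
    · rw [ofColex_colexBasis_self]
    · rw [ofColex_colexBasis_of_ne hne]
      exact zero_le_one
  have hbasis' : ∀ j, i < j → ofColex (colexBasis i) j = 0 :=
    fun j hj => ofColex_colexBasis_of_ne hj.ne
  rcases lt_trichotomy a b with hab | rfl | hab
  · refine colex_lt_of_leading (j := b) (fun l hl => hbasis' l (hib.trans_lt hl)) ?_ ?_
    · intro l hl
      rw [ofColex_add, Finsupp.add_apply, ha l (hab.trans hl), hb l hl, add_zero]
    · rw [ofColex_add, Finsupp.add_apply, ha b hab, zero_add, hbasis' b (hia.trans_lt hab)]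
      exact hb'
  · refine colex_lt_of_leading (j := a) (fun l hl => hbasis' l (hib.trans_lt hl)) ?_ ?_
    · intro l hl
      rw [ofColex_add, Finsupp.add_apply, ha l hl, hb l hl, add_zero]
    · rw [ofColex_add, Finsupp.add_apply]
      have := hbasis a hia
      omega
  · refine colex_lt_of_leading (j := a) (fun l hl => hbasis' l (hia.trans_lt hl)) ?_ ?_
    · intro l hl
      rw [ofColex_add, Finsupp.add_apply, ha l hl, hb l (hab.trans hl), add_zero]
    · rw [ofColex_add, Finsupp.add_apply, hb a hab, add_zero, hbasis' a (hib.trans_lt hab)]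
      exact ha'

theorem colexBasis_le_of_pos {i₀ : ι} (hi₀ : ∀ i, i₀ ≤ i) {γ : Colex (ι →₀ ℤ)} (h : 0 < γ) :
    colexBasis i₀ ≤ γ := by
  obtain ⟨j, hj, hj'⟩ := exists_colex_leading h
  rcases (hi₀ j).lt_or_eq with hlt | rfl
  · refine (colex_lt_of_leading (j := j) (fun l hl => ofColex_colexBasis_of_ne
      (hlt.trans hl).ne) hj ?_).le
    rwa [ofColex_colexBasis_of_ne hlt.ne]
  · by_contra! hlt
    obtain ⟨l, hl, hl'⟩ := Finsupp.Colex.lt_iff.1 hlt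
    rcases (hi₀ l).lt_or_eq with h1 | rfl
    · have h2 : ofColex γ l = 0 := hj l h1
      have h3 : ofColex (colexBasis i₀) l = 0 := ofColex_colexBasis_of_ne h1.ne
      change ofColex γ l < ofColex (colexBasis i₀) l at hl'
      omega
    · change ofColex γ i₀ < ofColex (colexBasis i₀) i₀ at hl'
      rw [ofColex_colexBasis_self] at hl'
      omega

variable (k ι) in
/-- The monomial embedding of the polynomial ring in the Hahn series with exponents in `ℤ^(ι)`. -/
noncomputable def monomialHahn : MvPolynomial ι k →ₐ[k] HahnSeries (Colex (ι →₀ ℤ)) k :=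
  MvPolynomial.aeval fun i => HahnSeries.single (colexBasis i) 1

theorem monomialHahn_X (i : ι) :
    monomialHahn k ι (MvPolynomial.X i) = HahnSeries.single (colexBasis i) 1 :=
  MvPolynomial.aeval_X _ _

theorem monomialHahn_monomial (s : ι →₀ ℕ) (c : k) :
    monomialHahn k ι (MvPolynomial.monomial s c) = HahnSeries.single (colexExponent s) c := by
  have h : (s.prod fun i n => HahnSeries.single (colexBasis i) (1 : k) ^ n) =
      HahnSeries.single (colexExponent s) 1 := by
    induction s using Finsupp.induction_linear with
    | zero =>
      rw [Finsupp.prod_zero_index]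
      rfl
    | add s t hs ht =>
      rw [Finsupp.prod_add_index' (by simp) (by intros; rw [pow_add]), hs, ht,
        HahnSeries.single_mul_single, mul_one, colexExponent_add]
    | single i n =>
      rw [Finsupp.prod_single_index (by simp), HahnSeries.single_pow, one_pow,
        colexExponent_single]
  rw [monomialHahn, MvPolynomial.aeval_monomial, h]
  change HahnSeries.single 0 c * _ = _
  rw [HahnSeries.single_mul_single, zero_add, mul_one]

theorem coeff_monomialHahn (p : MvPolynomial ι k) (s : ι →₀ ℕ) :
    (monomialHahn k ι p).coeff (colexExponent s) = p.coeff s := by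
  classical
  induction p using MvPolynomial.induction_on' with
  | monomial t c =>
    rw [monomialHahn_monomial, HahnSeries.coeff_single, MvPolynomial.coeff_monomial]
    simp only [colexExponent_injective.eq_iff, eq_comm]
  | add p q hp hq => rw [map_add, HahnSeries.coeff_add, hp, hq, MvPolynomial.coeff_add]

theorem monomialHahn_injective : Function.Injective (monomialHahn k ι) := by
  rw [injective_iff_map_eq_zero]
  intro p hp
  ext s
  rw [← coeff_monomialHahn, hp]
  rfl

end Colex

theorem Order.krullDim_fin_succ (m : ℕ) : Order.krullDim (Fin (m + 1)) = m := by
  apply le_antisymm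
  · refine iSup_le fun p => ?_
    have h := p.length_lt_card
    rw [Fintype.card_fin] at h
    exact_mod_cast Nat.lt_succ_iff.1 h
  · have h := LTSeries.length_le_krullDim
      (LTSeries.mk m (id : Fin (m + 1) → Fin (m + 1)) strictMono_id)
    exact h

/-! ### Primes of the valuation ring of the monomial valuation -/

section MonomialValuation

variable {L : Type v} [Field L] {ι : Type w} [LinearOrder ι]
  {ν : AddValuation L (WithTop (Colex (ι →₀ ℤ)))} {x : ι → ValuationSubring.ofAddValuation ν}

namespace ValuationSubring

theorem exists_dvd_pow_of_eq_colexBasis (hx : ∀ i, ν (x i : L) = colexBasis i)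
    {z : ofAddValuation ν} (hz0 : z ≠ 0) (hz : ¬ IsUnit z) :
    ∃ i, ∃ n : ℕ, x i ∣ z ^ n ∧ z ∣ x i ^ n := by
  have hz' : 0 < ν z := mem_maximalIdeal_ofAddValuation.1 hz
  obtain ⟨γ, hγ, -⟩ := ν.exists_eq_coe (z := (z : L)) (by simpa using hz0)
  rw [hγ] at hz'
  obtain ⟨i, n, h1, h2⟩ := exists_colexBasis_archimedean (by exact_mod_cast hz' : 0 < γ)
  refine ⟨i, n, ofAddValuation_dvd_iff.2 ?_, ofAddValuation_dvd_iff.2 ?_⟩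
  · change ν (x i : L) ≤ ν ((z : L) ^ n)
    rw [AddValuation.map_pow, hγ, hx]
    exact_mod_cast h1
  · change ν (z : L) ≤ ν ((x i : L) ^ n)
    rw [AddValuation.map_pow, hγ, hx]
    exact_mod_cast h2

theorem not_dvd_pow_of_lt (hx : ∀ i, ν (x i : L) = colexBasis i) {i j : ι} (h : i < j) (n : ℕ) :
    ¬ x j ∣ x i ^ n := by
  rw [ofAddValuation_dvd_iff]
  change ¬ ν (x j : L) ≤ ν ((x i : L) ^ n)
  rw [AddValuation.map_pow, hx, hx, not_le]
  exact_mod_cast nsmul_colexBasis_lt h n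

theorem dvd_of_le (hx : ∀ i, ν (x i : L) = colexBasis i) {i j : ι} (h : i ≤ j) : x i ∣ x j := by
  rcases h.eq_or_lt with rfl | h
  · exact dvd_rfl
  · rw [ofAddValuation_dvd_iff, hx, hx]
    have := nsmul_colexBasis_lt h 1
    rw [one_nsmul] at this
    exact_mod_cast this.le

theorem not_isUnit_of_eq_colexBasis (hx : ∀ i, ν (x i : L) = colexBasis i) (i : ι) :
    ¬ IsUnit (x i) := by
  have h : x i ∈ IsLocalRing.maximalIdeal (ofAddValuation ν) := by
    rw [mem_maximalIdeal_ofAddValuation, hx]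
    exact_mod_cast colexBasis_pos i
  exact h

theorem ne_zero_of_eq_colexBasis (hx : ∀ i, ν (x i : L) = colexBasis i) (i : ι) : x i ≠ 0 := by
  intro h
  have := hx i
  rw [h] at this
  simp at this

/-- The nonzero primes are the radicals of the ideals generated by one of the `x i`: each nonunit
has the same radical as some `x i`. -/
theorem exists_eq_radical_of_eq_colexBasis [WellFoundedLT ι]
    (hx : ∀ i, ν (x i : L) = colexBasis i) {P : Ideal (ofAddValuation ν)} (hP : P.IsPrime)
    (h0 : P ≠ ⊥) : ∃ i, P = (Ideal.span {x i}).radical := by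
  have hmem : ∀ z ∈ P, z ≠ 0 → ∃ i, x i ∈ P ∧ ∃ n : ℕ, x i ∣ z ^ n := by
    intro z hz hz0
    obtain ⟨i, n, h1, h2⟩ := exists_dvd_pow_of_eq_colexBasis hx hz0
      (fun h => hP.ne_top (P.eq_top_of_isUnit_mem hz h))
    exact ⟨i, hP.mem_of_pow_mem n (P.mem_of_dvd h2 hz), n, h1⟩
  obtain ⟨z, hz, hz0⟩ := Submodule.exists_mem_ne_zero_of_ne_bot h0
  obtain ⟨i₁, hi₁, -⟩ := hmem z hz hz0
  obtain ⟨i, hi, hmin⟩ := WellFounded.has_min (wellFounded_lt (α := ι)) {i | x i ∈ P} ⟨i₁, hi₁⟩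
  refine ⟨i, le_antisymm (fun y hy => ?_) ?_⟩
  · by_cases hy0 : y = 0
    · rw [hy0]
      exact Ideal.zero_mem _
    · obtain ⟨j, hj, n, hn⟩ := hmem y hy hy0
      exact ⟨n, Ideal.mem_span_singleton.2
        ((dvd_of_le hx (not_lt.1 (hmin j hj))).trans hn)⟩
  · rw [hP.radical_le_iff, Ideal.span_singleton_le_iff_mem]
    exact hi

/-- The radical of the ideal generated by `x i` is not idempotent, since all elements of its square
have a value larger than `e_i`. -/
theorem isStronglyDiscrete_of_eq_colexBasis [WellFoundedLT ι]
    (hx : ∀ i, ν (x i : L) = colexBasis i) : IsStronglyDiscrete (ofAddValuation ν) := by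
  intro P hP h0 hidem
  obtain ⟨i, rfl⟩ := exists_eq_radical_of_eq_colexBasis hx hP h0
  have key : ∀ y ∈ (Ideal.span {x i}).radical * (Ideal.span {x i}).radical,
      (colexBasis i : WithTop (Colex (ι →₀ ℤ))) < ν (y : L) := by
    have hle : ∀ z ∈ (Ideal.span {x i}).radical, (z : L) ≠ 0 →
        ∃ γ : Colex (ι →₀ ℤ), ν (z : L) = γ ∧ ∃ n : ℕ, colexBasis i ≤ n • γ := by
      rintro z ⟨n, hn⟩ hz0
      obtain ⟨γ, hγ, -⟩ := ν.exists_eq_coe hz0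
      refine ⟨γ, hγ, n, ?_⟩
      rw [Ideal.mem_span_singleton, ofAddValuation_dvd_iff, hx] at hn
      change _ ≤ ν ((z : L) ^ n) at hn
      rw [AddValuation.map_pow, hγ] at hn
      exact_mod_cast hn
    intro y hy
    refine Submodule.mul_induction_on hy (fun a ha b hb => ?_) (fun a b ha hb => ?_)
    · change _ < ν ((a : L) * b)
      rw [AddValuation.map_mul]
      by_cases ha0 : (a : L) = 0
      · simp [ha0]
      by_cases hb0 : (b : L) = 0
      · simp [hb0]
      obtain ⟨γ, hγ, n, hn⟩ := hle a ha ha0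
      obtain ⟨δ, hδ, m, hm⟩ := hle b hb hb0
      rw [hγ, hδ]
      exact_mod_cast colexBasis_lt_add hn hm
    · exact (lt_min ha hb).trans_le (AddValuation.map_add ν _ _)
  have := key (x i) (by rw [hidem]; exact Ideal.le_radical (Ideal.mem_span_singleton_self _))
  rw [hx] at this
  exact lt_irrefl _ this

/-- The primes are the radicals of the ideals generated by the `x i`, which decrease with `i`, and
the zero ideal. -/
theorem ringKrullDim_of_eq_colexBasis [WellFoundedLT ι] [Nonempty ι]
    (hx : ∀ i, ν (x i : L) = colexBasis i) :
    ringKrullDim (ofAddValuation ν) = Order.krullDim ι + 1 := by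
  have hprime : ∀ i, (Ideal.span {x i}).radical.IsPrime := fun i =>
    isPrime_radical_span_singleton (not_isUnit_of_eq_colexBasis hx i)
  let F : WithTop ι → (PrimeSpectrum (ofAddValuation ν))ᵒᵈ := fun a =>
    OrderDual.toDual (match a with
      | ⊤ => ⊥
      | (i : ι) => ⟨_, hprime i⟩)
  have hmono : StrictMono F := by
    intro a b hab
    cases a with
    | top => exact absurd hab (not_top_lt)
    | coe i =>
      refine OrderDual.toDual_lt_toDual.2 ?_
      cases b with
      | top =>
        refine bot_lt_iff_ne_bot.2 fun h => ne_zero_of_eq_colexBasis hx i ?_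
        have h' : (Ideal.span {x i}).radical = ⊥ := congrArg PrimeSpectrum.asIdeal h
        rw [← Ideal.mem_bot, ← h']
        exact Ideal.le_radical (Ideal.mem_span_singleton_self _)
      | coe j =>
        have hij : i < j := by exact_mod_cast hab
        change (Ideal.span {x j}).radical < (Ideal.span {x i}).radical
        refine lt_of_le_of_ne (Ideal.radical_mono ?_) fun h => ?_
        · exact Ideal.span_singleton_le_span_singleton.2 (dvd_of_le hx hij.le)
        · have hi : x i ∈ (Ideal.span {x j}).radical := by
            rw [h]
            exact Ideal.le_radical (Ideal.mem_span_singleton_self _)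
          obtain ⟨n, hn⟩ := hi
          exact not_dvd_pow_of_lt hx hij n (Ideal.mem_span_singleton.1 hn)
  have hsurj : Function.Surjective F := by
    intro p
    by_cases h0 : (OrderDual.ofDual p).asIdeal = ⊥
    · exact ⟨⊤, congrArg OrderDual.toDual (PrimeSpectrum.ext h0.symm)⟩
    · obtain ⟨i, hi⟩ := exists_eq_radical_of_eq_colexBasis hx (OrderDual.ofDual p).isPrime h0
      exact ⟨i, congrArg OrderDual.toDual (PrimeSpectrum.ext hi.symm)⟩
  have h := Order.krullDim_eq_of_orderIso (hmono.orderIsoOfSurjective F hsurj)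
  rw [Order.krullDim_orderDual, Order.krullDim_WithTop] at h
  exact h.symm

end ValuationSubring

end MonomialValuation

/-! ### Pairs of valuation rings with the required dimensions -/

section Existence

/-- Nested valuation rings that both split as `k + 𝔪`, with the same `k`, are equal. -/
theorem ValuationSubring.eq_of_le_of_decomp {k : Type u} {L : Type v} [Field k] [Field L]
    [Algebra k L] {V W : ValuationSubring L} (h : V ≤ W) (hk : ∀ c : k, algebraMap k L c ∈ V)
    (hW : ∀ x : W, ∃ c : k, ∃ q ∈ IsLocalRing.maximalIdeal W,
      (x : L) = algebraMap k L c + (q : L)) : V = W := by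
  refine le_antisymm h fun x hx => ?_
  obtain ⟨c, q, hq, e⟩ := hW ⟨x, hx⟩
  change x = _ at e
  rw [e]
  refine V.add_mem _ _ (hk c) ?_
  rcases V.mem_or_inv_mem (q : L) with h1 | h1
  · exact h1
  · by_cases hq0 : (q : L) = 0
    · rw [hq0]
      exact V.zero_mem
    · exact absurd (IsUnit.of_mul_eq_one (⟨(q : L)⁻¹, h h1⟩ : W)
        (Subtype.ext (mul_inv_cancel₀ hq0))) hq

variable (k : Type u) [Field k] (ι : Type)

/-- Countably many variables embed in the field of Laurent series, as power series that are
algebraically independent. -/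
theorem exists_ringHom_fractionRing_hahnSeries_int [Countable ι] :
    ∃ φ : FractionRing (MvPolynomial ι k) →+* HahnSeries ℤ k,
      ∀ c, φ (algebraMap k _ c) = HahnSeries.C c := by
  obtain ⟨f, hf⟩ := PowerSeries.exists_algebraicIndependent k
  obtain ⟨e, he⟩ := exists_injective_nat ι
  have h : Function.Injective ((HahnSeries.ofPowerSeries ℤ k).comp
      (MvPolynomial.aeval (f ∘ e) : MvPolynomial ι k →ₐ[k] PowerSeries k).toRingHom) :=
    HahnSeries.ofPowerSeries_injective.comp (hf.comp e he)
  refine ⟨IsFractionRing.lift h, fun c => ?_⟩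
  rw [IsScalarTower.algebraMap_apply k (MvPolynomial ι k), IsFractionRing.lift_algebraMap]
  change HahnSeries.ofPowerSeries ℤ k (MvPolynomial.aeval (f ∘ e) (algebraMap k _ c)) = _
  rw [AlgHom.commutes]
  exact HahnSeries.ofPowerSeries_C c

variable [LinearOrder ι]

/-- The embedding of the field of rational functions in the Hahn series with exponents in
`ℤ^(ι)` that sends the variables to the monomials. -/
noncomputable def fractionMonomialHahn :
    FractionRing (MvPolynomial ι k) →+* HahnSeries (Colex (ι →₀ ℤ)) k :=
  IsFractionRing.lift (A := MvPolynomial ι k) (g := (monomialHahn k ι).toRingHom)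
    monomialHahn_injective

theorem fractionMonomialHahn_algebraMap (p : MvPolynomial ι k) :
    fractionMonomialHahn k ι (algebraMap _ _ p) = monomialHahn k ι p :=
  IsFractionRing.lift_algebraMap _ p

theorem fractionMonomialHahn_C (c : k) :
    fractionMonomialHahn k ι (algebraMap k _ c) = HahnSeries.C c := by
  rw [IsScalarTower.algebraMap_apply k (MvPolynomial ι k), fractionMonomialHahn_algebraMap,
    AlgHom.commutes]
  rfl

theorem hahnAddVal_fractionMonomialHahn_X (i : ι) :
    hahnAddVal (fractionMonomialHahn k ι) (algebraMap _ _ (MvPolynomial.X i : MvPolynomial ι k)) =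
      colexBasis i := by
  rw [hahnAddVal_apply, fractionMonomialHahn_algebraMap, monomialHahn_X,
    HahnSeries.orderTop_single one_ne_zero]

/-- On the field of rational functions with variables indexed by `ι`, the valuation rings of an
embedding in the Laurent series and of the monomial embedding form a pair. -/
theorem exists_valuationPair [OrderBot ι] [WellFoundedLT ι] [Countable ι] [Nontrivial ι] :
    ∃ P : ValuationPair k (FractionRing (MvPolynomial ι k)),
      IsStronglyDiscrete P.V₁ ∧ IsStronglyDiscrete P.V₂ ∧
        ringKrullDim P.V₁ = 1 ∧ ringKrullDim P.V₂ = Order.krullDim ι + 1 := by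
  obtain ⟨φ, hφ⟩ := exists_ringHom_fractionRing_hahnSeries_int k ι
  set ψ := fractionMonomialHahn k ι
  have hψ : ∀ c, ψ (algebraMap k _ c) = HahnSeries.C c := fractionMonomialHahn_C k ι
  have hX := hahnAddVal_fractionMonomialHahn_X k ι
  have hpos : ∀ i : ι, 0 < hahnAddVal ψ (algebraMap _ _ (MvPolynomial.X i : MvPolynomial ι k)) := by
    intro i
    rw [hX]
    exact_mod_cast colexBasis_pos i
  let x : ι → ValuationSubring.ofAddValuation (hahnAddVal ψ) := fun i =>
    ⟨algebraMap _ _ (MvPolynomial.X i : MvPolynomial ι k), (hpos i).le⟩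
  have hx : ∀ i, hahnAddVal ψ (x i : FractionRing (MvPolynomial ι k)) = colexBasis i := hX
  have hdim₂ := ValuationSubring.ringKrullDim_of_eq_colexBasis hx
  have hsd₂ := ValuationSubring.isStronglyDiscrete_of_eq_colexBasis hx
  -- a variable has value `colexBasis i ≠ 0`, and nonzero constants have value `0`
  have hconst : (x ⊥ : FractionRing (MvPolynomial ι k)) ∉ Set.range (algebraMap k _) := by
    rintro ⟨c, hc⟩
    have hc0 : c ≠ 0 := by
      rintro rfl
      rw [map_zero] at hc
      exact ValuationSubring.ne_zero_of_eq_colexBasis hx ⊥ (Subtype.ext hc.symm)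
    have h1 := hx ⊥
    rw [← hc, hahnAddVal_apply, hψ] at h1
    have h2 : (HahnSeries.single (0 : Colex (ι →₀ ℤ)) c).orderTop = colexBasis (⊥ : ι) := h1
    rw [HahnSeries.orderTop_single hc0] at h2
    exact (colexBasis_pos (⊥ : ι)).ne (by exact_mod_cast h2)
  obtain ⟨z, hz0, hz⟩ := exists_hahnAddVal_pos hφ hconst
  have hdim₁ := ValuationSubring.ringKrullDim_ofAddValuation_int hz0 hz
  obtain ⟨π, hπ, hπmin⟩ := ValuationSubring.exists_min_ofAddValuation_int hz0 hz
  have hpr₁ := ValuationSubring.isPrincipal_ofAddValuation hπ hπmin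
  have hpr₂ : (IsLocalRing.maximalIdeal
      (ValuationSubring.ofAddValuation (hahnAddVal ψ))).IsPrincipal := by
    refine ValuationSubring.isPrincipal_ofAddValuation (hpos ⊥) fun y hy => ?_
    rw [hX]
    by_cases hy0 : y = 0
    · simp [hy0]
    · obtain ⟨γ, hγ, -⟩ := (hahnAddVal ψ).exists_eq_coe hy0
      rw [hγ] at hy ⊢
      exact_mod_cast colexBasis_le_of_pos (fun i => bot_le) (by exact_mod_cast hy)
  have hdec₁ := ValuationSubring.exists_decomp_ofAddValuation (k := k)
    fun y hy => exists_residue_hahnAddVal hφ (z := y) hy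
  have hdec₂ := ValuationSubring.exists_decomp_ofAddValuation (k := k)
    fun y hy => exists_residue_hahnAddVal hψ (z := y) hy
  have hne : ValuationSubring.ofAddValuation (hahnAddVal φ) ≠
      ValuationSubring.ofAddValuation (hahnAddVal ψ) := by
    intro h
    rw [h, hdim₂] at hdim₁
    obtain ⟨i, hi⟩ := exists_ne (⊥ : ι)
    have h1 : 1 ≤ Order.krullDim ι := Order.one_le_krullDim_iff.2 ⟨⊥, i, bot_lt_iff_ne_bot.2 hi⟩
    have h2 := add_le_add_left h1 1
    rw [hdim₁] at h2
    exact absurd h2 (by norm_num)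
  have hsd₁ : IsStronglyDiscrete (ValuationSubring.ofAddValuation (hahnAddVal φ)) := by
    have := isDiscreteValuationRing_of_ringKrullDim_eq_one hpr₁ hdim₁
    exact IsStronglyDiscrete.of_isPrincipalIdealRing _
  exact ⟨{
    V₁ := ValuationSubring.ofAddValuation (hahnAddVal φ)
    V₂ := ValuationSubring.ofAddValuation (hahnAddVal ψ)
    not_le₁₂ := fun h => hne (ValuationSubring.eq_of_le_of_decomp h
      (hahnAddVal_algebraMap_nonneg hφ) hdec₂)
    not_le₂₁ := fun h => hne (ValuationSubring.eq_of_le_of_decomp h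
      (hahnAddVal_algebraMap_nonneg hψ) hdec₁).symm
    principal₁ := hpr₁
    principal₂ := hpr₂
    mem₁ := hahnAddVal_algebraMap_nonneg hφ
    mem₂ := hahnAddVal_algebraMap_nonneg hψ
    decomp₁ := hdec₁
    decomp₂ := hdec₂ }, hsd₁, hsd₂, hdim₁, hdim₂⟩

theorem exists_valuationPair_of_two_le {n : ℕ∞} (hn : 2 ≤ n) :
    ∃ (L : Type u) (_ : Field L) (_ : Algebra k L) (P : ValuationPair k L),
      IsStronglyDiscrete P.V₁ ∧ IsStronglyDiscrete P.V₂ ∧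
        ringKrullDim P.V₁ = 1 ∧ ringKrullDim P.V₂ = n := by
  cases n using ENat.recTopCoe with
  | top =>
    obtain ⟨P, h₁, h₂, h₃, h₄⟩ := exists_valuationPair k ℕ
    refine ⟨_, _, _, P, h₁, h₂, h₃, ?_⟩
    rw [h₄, Order.krullDim_nat]
    rfl
  | coe n =>
    obtain ⟨m, rfl⟩ : ∃ m : ℕ, n = m + 2 :=
      ⟨n - 2, by have : 2 ≤ n := by exact_mod_cast hn
                 omega⟩
    obtain ⟨P, h₁, h₂, h₃, h₄⟩ := exists_valuationPair k (Fin (m + 2))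
    refine ⟨_, _, _, P, h₁, h₂, h₃, ?_⟩
    rw [h₄, Order.krullDim_fin_succ]
    norm_cast

end Existence

/-! ### Archimedean stable local domains with a given residue field -/

section Examples

theorem archimedean_and_stable_powerSeries (k : Type u) [Field k] :
    Function.Bijective (algebraMap k (IsLocalRing.ResidueField (PowerSeries k))) ∧
      ringKrullDim (PowerSeries k) = 1 ∧ IsArchimedeanDomain (PowerSeries k) ∧
        IsStableRing (PowerSeries k) ∧ SatisfiesACCP (PowerSeries k) := by
  have hdim : ringKrullDim (PowerSeries k) = 1 := by
    exact IsPrincipalIdealRing.ringKrullDim_eq_one _ (IsDiscreteValuationRing.not_isField _)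
  refine ⟨⟨(algebraMap k (IsLocalRing.ResidueField (PowerSeries k))).injective, ?_⟩, hdim, ?_, ?_,
    ?_⟩
  · intro y
    obtain ⟨f, rfl⟩ := IsLocalRing.residue_surjective y
    refine ⟨PowerSeries.constantCoeff f, ?_⟩
    rw [IsScalarTower.algebraMap_apply k (PowerSeries k) (IsLocalRing.ResidueField (PowerSeries k))]
    refine (Ideal.Quotient.eq).2 ?_
    rw [IsLocalRing.mem_maximalIdeal, mem_nonunits_iff, PowerSeries.isUnit_iff_constantCoeff]
    simp
  · exact isArchimedeanDomain_of_ringKrullDim_eq_one (RingHom.id (PowerSeries k))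
      Function.injective_id hdim
  · exact IsStableRing.of_isPrincipalIdealRing _
  · exact satisfiesACCP_of_isLocalHom (RingHom.id (PowerSeries k)) Function.injective_id

namespace ValuationPair

variable {k : Type u} {L : Type v} [Field k] [Field L] [Algebra k L] (P : ValuationPair k L)

theorem bijective_algebraMap_residueField :
    Function.Bijective (algebraMap k (IsLocalRing.ResidueField P.R)) := by
  refine ⟨(algebraMap k (IsLocalRing.ResidueField P.R)).injective, fun y => ?_⟩
  obtain ⟨r, rfl⟩ := IsLocalRing.residue_surjective y
  obtain ⟨c, m, hm, e⟩ := r.2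
  refine ⟨c, ?_⟩
  rw [IsScalarTower.algebraMap_apply k P.R (IsLocalRing.ResidueField P.R)]
  refine (Ideal.Quotient.eq).2 ?_
  rw [(P.MR_isMaximal_iff _).1 (IsLocalRing.maximalIdeal.isMaximal P.R), mem_MR_iff]
  have h : ((algebraMap k P.R c - r : P.R) : P.D) = -m := by
    change algebraMap k P.D c - (r : P.D) = -m
    rw [e]
    ring
  rw [h]
  exact P.M.neg_mem hm

end ValuationPair

theorem IsArchimedeanDomain.of_integralClosure_fractionRing {R : Type u} (L : Type v) [CommRing R]
    [IsDomain R] [Field L] [Algebra R L] [IsFractionRing R L]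
    (h : IsArchimedeanDomain (integralClosure R (FractionRing R))) :
    IsArchimedeanDomain (integralClosure R L) :=
  h.of_ringEquiv (FractionRing.algEquiv R L).mapIntegralClosure.toRingEquiv

theorem Algebra.HasGoingDown.of_integralClosure_fractionRing {R : Type u} {A : Type w}
    (L : Type v) [CommRing R] [IsDomain R] [CommRing A] [Algebra R A] [Field L] [Algebra R L]
    [IsFractionRing R L] (e : A ≃ₐ[R] integralClosure R L)
    (h : Algebra.HasGoingDown R (integralClosure R (FractionRing R))) :
    Algebra.HasGoingDown R A :=
  .of_algEquiv ((FractionRing.algEquiv R L).mapIntegralClosure.trans e.symm)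

theorem exists_archimedean_and_stable_of_two_le (k : Type u) [Field k] {n : ℕ∞} (hn : 2 ≤ n) :
    ∃ (R : Type u) (_ : CommRing R) (_ : IsDomain R) (_ : IsLocalRing R) (_ : Algebra k R),
      Function.Bijective (algebraMap k (IsLocalRing.ResidueField R)) ∧
        ringKrullDim R = n ∧ IsArchimedeanDomain R ∧ IsStableRing R ∧ SatisfiesACCP R ∧
        ¬ IsArchimedeanDomain (integralClosure R (FractionRing R)) ∧
        ¬ Algebra.HasGoingDown R (integralClosure R (FractionRing R)) := by
  obtain ⟨L, _, _, P, hs₁, hs₂, h₁, h₂⟩ := exists_valuationPair_of_two_le k hn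
  obtain ⟨hdim, ha, hs, hc, hna, hng⟩ := P.archimedean_and_stable_of_isStronglyDiscrete hn hs₁ hs₂ h₁ h₂
  have := P.isFractionRing_R
  refine ⟨P.R, inferInstance, inferInstance, inferInstance, inferInstance,
    P.bijective_algebraMap_residueField, hdim, ha, hs, hc, fun h => hna ?_, fun h => hng ?_⟩
  · exact h.of_integralClosure_fractionRing L
  · exact h.of_integralClosure_fractionRing L P.integralClosureEquiv

end Examples

theorem mainTheorem12 :
    -- the general proposition
    (∀ (k : Type u) (L : Type v) [Field k] [Field L] [Algebra k L] (P : ValuationPair k L),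
      -- (1)
      ((∀ I : Ideal P.D, I.IsMaximal ↔ I = P.N₁ ∨ I = P.N₂) ∧ P.N₁ ≠ P.N₂ ∧
        P.N₁.IsPrincipal ∧ P.N₂.IsPrincipal ∧
        (∀ x : L, x ∈ P.V₁ ↔ ∃ a s : P.D, s ∉ P.N₁ ∧ x = (a : L) / (s : L)) ∧
        (∀ x : L, x ∈ P.V₂ ↔ ∃ a s : P.D, s ∉ P.N₂ ∧ x = (a : L) / (s : L)) ∧
        IsPruferDomain P.D ∧ IsFractionRing P.D L ∧
        (∀ x : P.D, ∃ c : k, ∃ m ∈ P.N₁, x = algebraMap k P.D c + m) ∧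
        (∀ x : P.D, ∃ c : k, ∃ m ∈ P.N₂, x = algebraMap k P.D c + m)) ∧
      -- (2)
      ((∀ x : P.D, P.N₁ = Ideal.span {x} →
          ∀ d : P.D, ∃ r s : P.R, d = (r : P.D) + x * (s : P.D)) ∧
        (∃ a b : P.D, Submodule.span P.R {a, b} = ⊤) ∧
        P.M.IsPrincipal ∧
        (∃ a b : P.R, P.MR = Ideal.span {a, b}) ∧
        IsQuadraticExtension P.R P.D ∧
        IsFractionRing P.R L ∧
        -- `D` is the integral closure of `R`
        (∀ x : L, IsIntegral P.R x ↔ x ∈ P.D) ∧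
        -- `D = (M : M)`
        (∀ t : L, t ∈ P.D ↔ ∀ m ∈ P.M, ∃ m' ∈ P.M, t * (m : L) = (m' : L))) ∧
      -- (3)
      (IsLocalRing P.R ∧ ∀ I : Ideal P.R, I.IsMaximal ↔ I = P.MR) ∧
      -- (4)
      (IsFinitelyStableDomain P.R ∧ IsStableIdeal P.MR) ∧
      -- (5)
      ((IsStableRing P.R ↔ IsStableRing P.D) ∧
        (IsStableRing P.D ↔ IsStronglyDiscrete P.D)) ∧
      -- (6)
      ((IsArchimedeanDomain P.R ↔ ringKrullDim P.V₁ = 1 ∨ ringKrullDim P.V₂ = 1) ∧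
        (ringKrullDim P.V₁ = 1 → IsDiscreteValuationRing P.V₁) ∧
        (ringKrullDim P.V₂ = 1 → IsDiscreteValuationRing P.V₂)) ∧
      -- (7)
      (1 < ringKrullDim P.R ↔ 1 < ringKrullDim P.V₁ ∨ 1 < ringKrullDim P.V₂)) ∧
    -- the strongly discrete case
    (∀ (k : Type u) (L : Type v) [Field k] [Field L] [Algebra k L] (P : ValuationPair k L)
      (n : ℕ∞), 2 ≤ n → IsStronglyDiscrete P.V₁ → IsStronglyDiscrete P.V₂ →
      ringKrullDim P.V₁ = 1 → ringKrullDim P.V₂ = n →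
      IsLocalRing P.R ∧ ringKrullDim P.R = n ∧ IsArchimedeanDomain P.R ∧ IsStableRing P.R ∧
      SatisfiesACCP P.R ∧ ¬ IsArchimedeanDomain (integralClosure P.R L) ∧
      ¬ Algebra.HasGoingDown P.R P.D) ∧
    -- existence of the data, over every field and in every dimension
    (∀ (k : Type u) [Field k] (n : ℕ∞), 2 ≤ n →
      ∃ (L : Type u) (_ : Field L) (_ : Algebra k L) (P : ValuationPair k L),
        IsStronglyDiscrete P.V₁ ∧ IsStronglyDiscrete P.V₂ ∧
        ringKrullDim P.V₁ = 1 ∧ ringKrullDim P.V₂ = n) ∧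
    -- the resulting domains
    (∀ (k : Type u) [Field k] (n : ℕ∞), 1 ≤ n →
      ∃ (R : Type u) (_ : CommRing R) (_ : IsDomain R) (_ : IsLocalRing R) (_ : Algebra k R),
        Function.Bijective (algebraMap k (IsLocalRing.ResidueField R)) ∧
        ringKrullDim R = n ∧ IsArchimedeanDomain R ∧ IsStableRing R ∧ SatisfiesACCP R ∧
        (2 ≤ n → ¬ IsArchimedeanDomain (integralClosure R (FractionRing R)) ∧
          ¬ Algebra.HasGoingDown R (integralClosure R (FractionRing R)))) := by
  refine ⟨?_, ?_, ?_, ?_⟩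
  · intro k L _ _ _ P
    refine ⟨⟨P.isMaximal_iff, P.N₁_ne_N₂, ?_, ?_, P.mem_V₁_iff, P.mem_V₂_iff, P.isPruferDomain_D,
      P.isFractionRing_D, fun x => ?_, fun x => ?_⟩, ⟨fun x hx d => ?_, P.exists_span_pair_eq_top,
      ?_, P.exists_MR_eq_span_pair, P.isQuadraticExtension, P.isFractionRing_R, P.isIntegral_iff,
      P.mem_D_iff_mul_M⟩, ⟨P.isLocalRing_R, P.MR_isMaximal_iff⟩,
      ⟨P.isFinitelyStableDomain_R, P.isStableIdeal_MR⟩,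
      ⟨P.isStableRing_R_iff, P.isStableRing_D_iff⟩, ⟨P.isArchimedeanDomain_R_iff,
      isDiscreteValuationRing_of_ringKrullDim_eq_one P.principal₁,
      isDiscreteValuationRing_of_ringKrullDim_eq_one P.principal₂⟩, ?_⟩
    · obtain ⟨x, hx, -⟩ := P.exists_generator_N₁
      exact ⟨x, hx⟩
    · obtain ⟨x, hx, -⟩ := P.exists_generator_N₂
      exact ⟨x, hx⟩
    · obtain ⟨c, hc⟩ := P.exists_sub_mem_N₁ x
      exact ⟨c, _, hc, by ring⟩
    · obtain ⟨c, hc⟩ := P.exists_sub_mem_N₂ x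
      exact ⟨c, _, hc, by ring⟩
    · exact P.exists_eq_add_mul (P.notMem_R_of_N₁_eq_span hx) d
    · obtain ⟨m, hm, -⟩ := P.exists_generator_M
      exact ⟨m, hm⟩
    · rw [P.ringKrullDim_R, lt_max_iff]
  · intro k L _ _ _ P n hn hV₁ hV₂ h₁ h₂
    exact ⟨P.isLocalRing_R, P.archimedean_and_stable_of_isStronglyDiscrete hn hV₁ hV₂ h₁ h₂⟩
  · intro k _ n hn
    exact exists_valuationPair_of_two_le k hn
  · intro k _ n hn
    rcases hn.eq_or_lt with rfl | hn
    · obtain ⟨h₁, h₂, h₃, h₄, h₅⟩ := archimedean_and_stable_powerSeries k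
      exact ⟨PowerSeries k, inferInstance, inferInstance, inferInstance, inferInstance, h₁, h₂,
        h₃, h₄, h₅, fun h => absurd h (by norm_num)⟩
    · obtain ⟨R, i₁, i₂, i₃, i₄, h₁, h₂, h₃, h₄, h₅, h₆⟩ := exists_archimedean_and_stable_of_two_le k
        (n := n) (by simpa [one_add_one_eq_two] using Order.add_one_le_of_lt hn)
      exact ⟨R, i₁, i₂, i₃, i₄, h₁, h₂, h₃, h₄, h₅, fun _ => h₆⟩
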